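/- Let $\Sigma$ be a finite alphabet. A \emph{timed word} over $\Sigma$ is a non-empty finite sequence $(a_1,t_1)\dots(a_n,t_n)$ with $a_i\in\Sigma$, $t_i\in\mathbb{R}_{\ge 0}$ and $t_1\le\dots\le t_n$. A \emph{timed pushdown automaton} over $\Sigma$ consists of a finite stack alphabet $\Gamma$, a finite set of locations with sets of initial and accepting locations, a finite set $\mathcal X$ of clocks, and a finite set of edges $(l,a,\phi,\mathsf{op},\lambda,l')$, where $l,l'$ are locations, $a\in\Sigma$, $\phi$ is a conjunction of constraints $x\sim c$ with $x\in\mathcal X$, $c\in\mathbb N$, $\sim\,\in\{<,\le,=,\ge,>\}$ (the empty conjunction being $\mathtt{true}$), $\mathsf{op}$ is one of $pop(\gamma)$, $push(\gamma)$ ($\gamma\in\Gamma$), $noop$, $empty?$, and $\lambda\subseteq\mathcal X$ is a set of clocks to be reset. A state consists of a location, a valuation $\nu:\mathcal X\to\mathbb R_{\ge0}$ and a stack content. A step lets an amount $\delta\ge0$ of time elapse and then takes an edge from the current location such that $\nu+\delta$ satisfies $\phi$ and the stack operation is possible ($pop(\gamma)$ requires $\gamma$ on top of the stack, and $empty?$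 requires the empty stack); the new valuation is $\nu+\delta$ with the clocks in $\lambda$ set to $0$. The language $L(\mathcal A)$ is the set of timed words $(a_1,\delta_1)(a_2,\delta_1+\delta_2)\dots(a_n,\delta_1+\dots+\delta_n)$ read along runs from an initial location, with all clocks $0$ and the empty stack, to an accepting location. A \emph{timed visibly one-counter net} is a timed pushdown automaton in which $|\Gamma|=1$, no edge carries the operation $empty?$, and $\Sigma$ can be partitioned into sets of internal, call and return symbols such that, for every edge, its letter is internal if and only if its operation is $noop$, call if and only if its operation is a $push$, and return if and only if its operation is a $pop$. A timed visibly one-counter net without clocks is \emph{deterministic} if no two distinct edges have the same source location and the same letter. \emph{MTL formulae} over $\Sigma$ are given by $\varphi::=\mathtt{true}\mid a\mid\neg\varphi\mid\varphi_1\wedge\varphi_2\mid\varphi_1\mathsf U_I\varphi_2$, where $a\in\Sigma$ and $I\subseteq\mathbb R_{\ge0}$ is an open, closed or half-open interval with endpoints in $\mathbb N\cup\{\infty\}$. For a timed word $w=(a_1,t_1)\dots(a_n,t_n)$ and $1\le i\le n$: $(w,i)\models a$ if and only if $a_i=a$; $\mathtt{true}$, $\neg$ and $\wedge$ are interpreted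 as usual; and $(w,i)\models\varphi_1\mathsf U_I\varphi_2$ if and only if there is $j$ with $i<j\le n$, $(w,j)\models\varphi_2$, $t_j-t_i\in I$, and $(w,k)\models\varphi_1$ for all $k$ with $i<k<j$. We write $w\models\varphi$ if $(w,1)\models\varphi$. \textbf{Theorem.} The model checking problem for timed visibly one-counter nets and MTL over finite timed words, namely: given a timed visibly one-counter net $\mathcal A$ and an MTL formula $\varphi$ over the same finite alphabet, does every $w\in L(\mathcal A)$ satisfy $\varphi$? is undecidable. It remains undecidable when restricted to timed visibly one-counter nets that have no clocks and are deterministic. -/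

import Mathlib

open scoped NNReal

namespace TimedMC

/-! ### Timed words -/

/-- A finite timed word over `σ`: a non-empty finite sequence of letters with non-decreasing
timestamps in the non-negative reals. -/
def TimedWord (σ : Type) : Type :=
  {w : List (σ × ℝ≥0) // w ≠ [] ∧ (w.map Prod.snd).Pairwise (· ≤ ·)}

/-! ### Clock constraints and stack operations -/

/-- The comparison symbols `<, ≤, =, ≥, >`. -/
inductive Cmp
  | lt
  | le
  | eq
  | ge
  | gt

/-- `x ∼ c`. -/
def Cmp.Holds : Cmp → ℝ≥0 → ℕ → Prop
  | .lt, x, c => x < c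
  | .le, x, c => x ≤ c
  | .eq, x, c => x = c
  | .ge, x, c => x ≥ c
  | .gt, x, c => x > c

/-- A clock constraint over the clocks `X`: a finite conjunction of atoms `x ∼ c` with `c ∈ ℕ`.
The empty conjunction is `true`; it is the only constraint if there are no clocks. -/
abbrev ClockConstraint (X : Type) : Type := List (X × Cmp × ℕ)

def ClockConstraint.Holds {X : Type} (φ : ClockConstraint X) (ν : X → ℝ≥0) : Prop :=
  ∀ at' ∈ φ, at'.2.1.Holds (ν at'.1) at'.2.2

/-- The stack operations over the stack alphabet `Γ`. -/
inductive StackOp (Γ : Type)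
  | pop (γ : Γ)
  | push (γ : Γ)
  | noop
  | isEmpty

/-- Effect of a stack operation; the top of the stack is the head of the list. -/
def StackOp.Rel {Γ : Type} : StackOp Γ → List Γ → List Γ → Prop
  | .pop γ, u, u' => u = γ :: u'
  | .push γ, u, u' => u' = γ :: u
  | .noop, u, u' => u' = u
  | .isEmpty, u, u' => u = [] ∧ u' = []

/-! ### Timed pushdown automata -/

/-- An edge `(l, a, φ, op, R, l')`. -/
@[ext]
structure Edge (σ Γ L X : Type) where
  src : L
  letter : σ
  guard : ClockConstraint X
  op : StackOp Γ
  reset : Finset X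
  tgt : L

/-- A timed pushdown automaton with input alphabet `σ`, stack alphabet `Γ`, locations `L` and
clocks `X` (all of these are meant to be finite). -/
@[ext]
structure TimedPDA (σ Γ L X : Type) where
  init : Finset L
  final : Finset L
  edges : Finset (Edge σ Γ L X)

/-- A state: location, clock valuation and stack content. -/
structure State (Γ L X : Type) where
  loc : L
  val : X → ℝ≥0
  stack : List Γ

namespace TimedPDA

variable {σ Γ L X : Type}

/-- The transition relation: let `δ` time units elapse, then take an edge labelled `a`. -/
def Step (A : TimedPDA σ Γ L X) (s : State Γ L X) (δ : ℝ≥0) (a : σ) (s' : State Γ L X) : Prop :=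
  ∃ e ∈ A.edges, e.src = s.loc ∧ e.letter = a ∧ e.tgt = s'.loc ∧
    e.guard.Holds (fun x => s.val x + δ) ∧
    (∀ x, (x ∈ e.reset → s'.val x = 0) ∧ (x ∉ e.reset → s'.val x = s.val x + δ)) ∧
    e.op.Rel s.stack s'.stack

/-- `A.Run t s w s'`: there is a run from `s` to `s'` which, when started at absolute time `t`,
has the associated sequence `w` of letters with absolute timestamps. -/
inductive Run (A : TimedPDA σ Γ L X) :
    ℝ≥0 → State Γ L X → List (σ × ℝ≥0) → State Γ L X → Prop
  | nil (t : ℝ≥0) (s : State Γ L X) : Run A t s [] s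
  | cons {t δ : ℝ≥0} {s s' s'' : State Γ L X} {a : σ} {w : List (σ × ℝ≥0)} :
      A.Step s δ a s' → Run A (t + δ) s' w s'' → Run A t s ((a, t + δ) :: w) s''

/-- The timed language accepted by `A`. -/
def language (A : TimedPDA σ Γ L X) : Set (TimedWord σ) :=
  {w | ∃ s s' : State Γ L X, s.loc ∈ A.init ∧ (∀ x, s.val x = 0) ∧ s.stack = [] ∧
    s'.loc ∈ A.final ∧ A.Run 0 s w.1 s'}

/-- One-counter automaton: the stack alphabet is a singleton. -/
def IsOneCounter (_A : TimedPDA σ Γ L X) : Prop := Nat.card Γ = 1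

/-- There are no zero tests. -/
def HasNoZeroTests (A : TimedPDA σ Γ L X) : Prop := ∀ e ∈ A.edges, e.op ≠ .isEmpty

/-- Kinds of input symbols. A function `σ → SymbolKind` is a partition of `σ` into three
pairwise disjoint (possibly empty) sets. -/
inductive SymbolKind
  | internal
  | call
  | ret

/-- Timed visibly pushdown automaton: the input alphabet can be partitioned into internal, call and
return symbols such that the input symbol determines the kind of stack operation. -/
def IsVisibly (A : TimedPDA σ Γ L X) : Prop :=
  ∃ kind : σ → SymbolKind, ∀ e ∈ A.edges,
    (kind e.letter = .internal ↔ e.op = .noop) ∧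
    (kind e.letter = .call ↔ ∃ γ, e.op = .push γ) ∧
    (kind e.letter = .ret ↔ e.op = .isEmpty ∨ ∃ γ, e.op = .pop γ)

/-- Timed visibly one-counter nets. -/
def IsVisiblyOneCounterNet (A : TimedPDA σ Γ L X) : Prop :=
  A.IsOneCounter ∧ A.HasNoZeroTests ∧ A.IsVisibly

def HasNoClocks (_A : TimedPDA σ Γ L X) : Prop := IsEmpty X

/-- Determinism, for automata without clocks (all guards are `true`, all resets are empty):
two distinct edges with the same source and the same letter are a pop and a zero test. -/
def IsDeterministic (A : TimedPDA σ Γ L X) : Prop :=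
  ∀ e ∈ A.edges, ∀ e' ∈ A.edges, e.src = e'.src → e.letter = e'.letter → e ≠ e' →
    ((∃ γ, e.op = .pop γ) ∧ e'.op = .isEmpty) ∨ (e.op = .isEmpty ∧ ∃ γ, e'.op = .pop γ)

end TimedPDA

/-! ### Metric temporal logic -/

/-- Syntax of an interval of non-negative reals with endpoints in `ℕ ∪ {∞}`; `hi = none` is `∞`. -/
@[ext]
structure Interval where
  lo : ℕ
  loClosed : Bool
  hi : Option ℕ
  hiClosed : Bool

/-- The interval as a set of reals. -/
def Interval.toSet (I : Interval) : Set ℝ :=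
  {d | (if I.loClosed then (I.lo : ℝ) ≤ d else (I.lo : ℝ) < d) ∧
    ∀ h ∈ I.hi, if I.hiClosed then d ≤ (h : ℝ) else d < (h : ℝ)}

/-- Formulae of MTL over the alphabet `σ`. -/
inductive MTL (σ : Type)
  | tt
  | atom (a : σ)
  | neg (φ : MTL σ)
  | and (φ ψ : MTL σ)
  | untl (I : Interval) (φ ψ : MTL σ)

/-- Pointwise semantics (strict until) at the positions of a timed word. -/
def MTL.Sat {σ : Type} (w : List (σ × ℝ≥0)) : MTL σ → Fin w.length → Prop
  | .tt, _ => True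
  | .atom a, i => (w.get i).1 = a
  | .neg φ, i => ¬ φ.Sat w i
  | .and φ ψ, i => φ.Sat w i ∧ ψ.Sat w i
  | .untl I φ ψ, i => ∃ j, i < j ∧ ψ.Sat w j ∧
      ((w.get j).2 : ℝ) - ((w.get i).2 : ℝ) ∈ I.toSet ∧ ∀ k, i < k → k < j → φ.Sat w k

/-- A timed word satisfies a formula if the formula holds at its first position. -/
def TimedWord.Models {σ : Type} (w : TimedWord σ) (φ : MTL σ) : Prop :=
  φ.Sat w.1 ⟨0, List.length_pos_of_ne_nil w.2.1⟩

/-! ### Model checking as a decision problem -/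

/-- An input of the model checking problem: an automaton and a formula over the same alphabet.
All finite sets are, up to renaming, initial segments of `ℕ`. -/
structure Instance where
  numLetters : ℕ
  numStack : ℕ
  numLocs : ℕ
  numClocks : ℕ
  aut : TimedPDA (Fin numLetters) (Fin numStack) (Fin numLocs) (Fin numClocks)
  formula : MTL (Fin numLetters)

/-- The question: does every timed word accepted by the automaton satisfy the formula? -/
def Instance.Holds (P : Instance) : Prop := ∀ w ∈ P.aut.language, w.Models P.formula

def Cmp.code : Cmp → ℕ
  | .lt => 0
  | .le => 1
  | .eq => 2
  | .ge => 3
  | .gt => 4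

def StackOp.code {g : ℕ} : StackOp (Fin g) → ℕ × ℕ
  | .pop γ => (0, γ)
  | .push γ => (1, γ)
  | .noop => (2, 0)
  | .isEmpty => (3, 0)

abbrev EdgeCode : Type := ℕ × ℕ × List (ℕ × ℕ × ℕ) × (ℕ × ℕ) × List Bool × ℕ

/-- Explicit description of an edge; the reset set is written as its characteristic vector. -/
def Edge.code {a g l k : ℕ} (e : Edge (Fin a) (Fin g) (Fin l) (Fin k)) : EdgeCode :=
  (e.src, e.letter, e.guard.map (fun c => ((c.1 : ℕ), c.2.1.code, c.2.2)), e.op.code,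
    (List.finRange k).map (fun x => decide (x ∈ e.reset)), e.tgt)

def endpointCode : Option ℕ → ℕ
  | none => 0
  | some n => n + 1

/-- A formula written in prefix notation, as a word over `ℕ`. -/
def MTL.code {a : ℕ} : MTL (Fin a) → List ℕ
  | .tt => [0]
  | .atom x => [1, (x : ℕ)]
  | .neg φ => 2 :: φ.code
  | .and φ ψ => 3 :: (φ.code ++ ψ.code)
  | .untl I φ ψ =>
      4 :: I.lo :: I.loClosed.toNat :: endpointCode I.hi :: I.hiClosed.toNat :: (φ.code ++ ψ.code)

/-- Descriptions of inputs: the four sizes, the initial locations, the accepting locations,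
the edges and the formula. -/
abbrev InstanceCode : Type :=
  (ℕ × ℕ × ℕ × ℕ) × List ℕ × List ℕ × List EdgeCode × List ℕ

/-- `c` describes `P`; the finite sets of locations and edges are listed in an arbitrary order. -/
def Describes (c : InstanceCode) (P : Instance) : Prop :=
  ∃ (is fs : List (Fin P.numLocs))
    (es : List (Edge (Fin P.numLetters) (Fin P.numStack) (Fin P.numLocs) (Fin P.numClocks))),
    (∀ q, q ∈ is ↔ q ∈ P.aut.init) ∧ (∀ q, q ∈ fs ↔ q ∈ P.aut.final) ∧
    (∀ e, e ∈ es ↔ e ∈ P.aut.edges) ∧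
    c = ((P.numLetters, P.numStack, P.numLocs, P.numClocks), is.map Fin.val,
      fs.map Fin.val, es.map Edge.code, P.formula.code)

/-- The model checking problem, for inputs in the class `C`, is decidable: some algorithm
(total computable function) answers correctly on every description of every input in `C`. -/
def ModelCheckingDecidable (C : Set Instance) : Prop :=
  ∃ f : InstanceCode → Bool, Computable f ∧
    ∀ P ∈ C, ∀ c, Describes c P → (f c = true ↔ P.Holds)

/-! ### Descriptions exist and are unambiguous -/

theorem exists_describes (P : Instance) : ∃ c, Describes c P :=
  ⟨_, P.aut.init.toList, P.aut.final.toList, P.aut.edges.toList, by simp, by simp, by simp, rfl⟩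

theorem Cmp.code_injective : Function.Injective Cmp.code := by
  intro x y h
  cases x <;> cases y <;> simp_all [Cmp.code]

theorem StackOp.code_injective {g : ℕ} :
    Function.Injective (StackOp.code : StackOp (Fin g) → ℕ × ℕ) := by
  intro x y h
  cases x <;> cases y <;> simp_all [StackOp.code, Fin.ext_iff]

theorem Edge.code_injective {a g l k : ℕ} :
    Function.Injective (Edge.code : Edge (Fin a) (Fin g) (Fin l) (Fin k) → EdgeCode) := by
  intro x y h
  simp only [Edge.code, Prod.mk.injEq] at h
  obtain ⟨h1, h2, h3, h4, h5, h6⟩ := h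
  apply Edge.ext
  · exact Fin.ext h1
  · exact Fin.ext h2
  · refine (List.map_injective_iff.2 ?_) h3
    rintro ⟨x1, c1, n1⟩ ⟨x2, c2, n2⟩ hh
    simp only [Prod.mk.injEq] at hh ⊢
    exact ⟨Fin.ext hh.1, Cmp.code_injective hh.2.1, hh.2.2⟩
  · exact StackOp.code_injective h4
  · ext i
    have := List.map_inj_left.1 h5 i (List.mem_finRange i)
    simpa using this
  · exact Fin.ext h6

theorem endpointCode_injective : Function.Injective endpointCode := by
  intro x y h
  cases x <;> cases y <;> simp_all [endpointCode]

theorem MTL.code_append_inj {a : ℕ} (φ : MTL (Fin a)) :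
    ∀ (ψ : MTL (Fin a)) (r s : List ℕ), φ.code ++ r = ψ.code ++ s → φ = ψ ∧ r = s := by
  induction φ with
  | tt => intro ψ r s h; cases ψ <;> simp_all [MTL.code]
  | atom x => intro ψ r s h; cases ψ <;> simp_all [MTL.code, Fin.ext_iff]
  | neg φ ih =>
    intro ψ r s h
    cases ψ <;> simp only [MTL.code, List.cons_append, List.cons.injEq] at h
    all_goals first | omega | skip
    obtain ⟨h1, h2⟩ := ih _ _ _ h.2
    exact ⟨by rw [h1], h2⟩
  | and φ ψ ih1 ih2 =>
    intro χ r s h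
    cases χ <;> simp only [MTL.code, List.cons_append, List.cons.injEq, List.append_assoc] at h
    all_goals first | omega | skip
    obtain ⟨h1, h2⟩ := ih1 _ _ _ h.2
    obtain ⟨h3, h4⟩ := ih2 _ _ _ h2
    exact ⟨by rw [h1, h3], h4⟩
  | untl I φ ψ ih1 ih2 =>
    intro χ r s h
    cases χ <;> simp only [MTL.code, List.cons_append, List.cons.injEq, List.append_assoc] at h
    all_goals first | omega | skip
    obtain ⟨-, h1, h2, h3, h4, h5⟩ := h
    obtain ⟨h6, h7⟩ := ih1 _ _ _ h5
    obtain ⟨h8, h9⟩ := ih2 _ _ _ h7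
    have hb : ∀ x y : Bool, x.toNat = y.toNat → x = y := by decide
    have hI : I = _ := Interval.ext h1 (hb _ _ h2) (endpointCode_injective h3)
      (hb _ _ h4)
    exact ⟨by rw [h6, h8, hI], h9⟩

theorem MTL.code_injective {a : ℕ} :
    Function.Injective (MTL.code : MTL (Fin a) → List ℕ) := by
  intro φ ψ h
  exact (MTL.code_append_inj φ ψ [] [] (by simpa using h)).1

theorem Describes.unique {c : InstanceCode} {P Q : Instance}
    (hP : Describes c P) (hQ : Describes c Q) : P = Q := by
  obtain ⟨is, fs, es, hi, hf, he, rfl⟩ := hP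
  obtain ⟨is', fs', es', hi', hf', he', h⟩ := hQ
  obtain ⟨a, g, l, k, A, φ⟩ := P
  obtain ⟨a', g', l', k', A', φ'⟩ := Q
  simp only [Prod.mk.injEq] at h
  obtain ⟨⟨rfl, rfl, rfl, rfl⟩, h1, h2, h3, h4⟩ := h
  obtain rfl := List.map_injective_iff.2 Fin.val_injective h1
  obtain rfl := List.map_injective_iff.2 Fin.val_injective h2
  obtain rfl := List.map_injective_iff.2 Edge.code_injective h3
  obtain rfl := MTL.code_injective h4
  have : A = A' := by
    ext x
    · rw [← hi, ← hi']
    · rw [← hf, ← hf']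
    · rw [← he, ← he']
  rw [this]

end TimedMC

namespace TimedMC

open TimedPDA Turing

/-! ### A finite Turing machine with undecidable halting problem -/

/-! The halting problem of one fixed Turing machine is reduced to the complement of model checking.
A computation is written as a timed word made of rows of equal length `N`. Each row opens with a
separator, lasts one time unit and holds one configuration, with the state attached to the scanned
cell. The first row consists of calls, the last one of returns, and the rows between them of
internal symbols.

MTL can require that time increases strictly, that calls come first and returns last, that every
letter other than a return has a letter exactly one time unit later, and that this later letter is
the one prescribed by the three neighbouring letters above it. It cannot look back, so letters
without a predecessor one time unit earlier may be inserted. The net excludes such insertions by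
counting: it pushes on calls and pops on returns, hence an accepted word has at most as many returns
as calls. Sending a letter to the one a time unit later is a strictly increasing map from the
non-returns to the non-calls, and by the count its target is no larger than its source. It is
therefore the shift by the number `N` of calls (`RowSystem.IsEncoding.later_eq`).

Without insertions the rows are the successive configurations, so a halting letter proves that the
machine halts (`TuringRows.dom_of_isEncoding`). Conversely, a halting computation needs only
finitely many cells and can be written in rows of sufficient length
(`TuringRows.exists_isEncoding`). The formula fixes the input but not the blank padding of the first
row, so the word itself guesses the space required.

The formula to be checked is the negation of the one describing encodings: it holds on the language
exactly if the machine does not halt. The net depends on the machine alone, and the input enters the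
formula as a block of its code, so the reduction is primitive recursive. Since the net is clockless
and deterministic, both undecidability claims follow. -/

/-- Makes the initial tape of the simulation an explicit, computable function of `n`. -/
theorem trNat_eq_bits (n : ℕ) :
    PartrecToTM2.trNat n =
      n.bits.map (fun b => bif b then PartrecToTM2.Γ'.bit1 else PartrecToTM2.Γ'.bit0) := by
  have key : ∀ p : PosNum, PartrecToTM2.trPosNum p =
      (p : ℕ).bits.map (fun b => bif b then PartrecToTM2.Γ'.bit1 else PartrecToTM2.Γ'.bit0) := by
    intro p
    induction p with
    | one => simp [PartrecToTM2.trPosNum]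
    | bit0 p ih =>
      rw [PartrecToTM2.trPosNum, ih, PosNum.cast_bit0, ← two_mul,
        Nat.bit0_bits _ (PosNum.cast_pos (α := ℕ) p).ne']
      rfl
    | bit1 p ih =>
      rw [PartrecToTM2.trPosNum, ih, PosNum.cast_bit1, ← two_mul, Nat.bit1_bits]
      rfl
  unfold PartrecToTM2.trNat
  rcases h : (n : Num) with _ | p
  · have : ((n : Num) : ℕ) = 0 := by rw [h]; rfl
    rw [Num.to_of_nat] at this
    subst this
    rfl
  · have : ((n : Num) : ℕ) = (p : ℕ) := by rw [h]; rfl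
    rw [Num.to_of_nat] at this
    subst this
    exact key p

/-- Course-of-values recursion: the digits of `n > 0` are its parity followed by the digits of `n /
2`. The argument `n` is recovered as the length of the list of earlier values. -/
theorem primrec_bits : Primrec Nat.bits := by
  have hf : Primrec₂ fun (_ : Unit) (l : List (List Bool)) =>
      (some (if l.length = 0 then [] else
        Nat.bodd l.length :: l.getD (Nat.div2 l.length) []) : Option (List Bool)) := by
    have hl : Primrec fun p : Unit × List (List Bool) => p.2.length :=
      Primrec.list_length.comp Primrec.snd
    refine Primrec.option_some.comp (Primrec.ite ?_ (Primrec.const _) ?_)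
    · exact Primrec.eq.comp hl (Primrec.const 0)
    · exact Primrec.list_cons.comp (Primrec.nat_bodd.comp hl)
        ((Primrec.list_getD []).comp Primrec.snd (Primrec.nat_div2.comp hl))
  have := Primrec.nat_strong_rec (fun (_ : Unit) (n : ℕ) => n.bits) hf ?_
  · exact this.comp (Primrec.const ()) Primrec.id
  · intro _ n
    simp only [List.length_map, List.length_range, Option.some.injEq]
    rcases Nat.eq_zero_or_pos n with rfl | hn
    · simp
    · have hlt : Nat.div2 n < n := by rw [Nat.div2_val]; omega
      rw [if_neg hn.ne']
      have : n.bits = Nat.bodd n :: (Nat.div2 n).bits := by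
        conv_lhs => rw [← Nat.bit_bodd_div2 n]
        refine Nat.bits_append_bit _ _ fun h => ?_
        have := Nat.bodd_add_div2 n
        rw [h] at this
        cases hb : Nat.bodd n
        · rw [hb] at this; simp at this; omega
        · rfl
      rw [this]
      simp [List.getD, hlt]

/-- A universal function suffices: the code evaluates the `n`-th partial recursive function at `0`.
Only the input varies, so the machine, and with it the alphabet of the rows, can be fixed once and
for all. -/
theorem exists_partrecCode_undecidable :
    ∃ c : ToPartrec.Code, ¬ ComputablePred fun n : ℕ => (c.eval [n]).Dom := by
  have hp : Partrec fun n : ℕ => (Denumerable.ofNat Nat.Partrec.Code n).eval 0 :=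
    Nat.Partrec.Code.eval_part.comp (Computable.ofNat _) (Computable.const 0)
  obtain ⟨c, hc⟩ := ToPartrec.Code.exists_code (Nat.Partrec'.part_iff₁.2 hp)
  refine ⟨c, fun h => ComputablePred.halting_problem 0 (ComputablePred.computable_iff.2 ?_)⟩
  obtain ⟨f, hf, hfe⟩ := ComputablePred.computable_iff.1 h
  refine ⟨fun d => f (Encodable.encode d), hf.comp Computable.encode, ?_⟩
  funext d
  rw [← congrFun hfe (Encodable.encode d)]
  have h2 : c.eval [Encodable.encode d] = _ := hc (Encodable.encode d ::ᵥ List.Vector.nil)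
  rw [h2, List.Vector.head_cons, Denumerable.ofNat_encode]
  simp

/-- Composes the simulations of codes by `TM2`, of `TM2` by `TM1` and of `TM1` by `TM0`. Their
support theorems leave finitely many reachable states, to which the machine is restricted. -/
theorem exists_tm0_undecidable :
    ∃ (Γ Q : Type) (_ : Inhabited Γ) (_ : Fintype Γ) (_ : Inhabited Q) (_ : Fintype Q)
      (M : TM0.Machine Γ Q) (g₀ : Γ) (g : Bool → Γ),
      ¬ ComputablePred fun n : ℕ =>
        (StateTransition.eval (TM0.step M) (TM0.init (g₀ :: n.bits.reverse.map g))).Dom := by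
  classical
  obtain ⟨c, hc⟩ := exists_partrecCode_undecidable
  let iΛ : Inhabited PartrecToTM2.Λ' := ⟨PartrecToTM2.trNormal c .halt⟩
  let iK : Fintype PartrecToTM2.K' := ⟨{.main, .rev, .aux, .stack}, by intro x; cases x <;> decide⟩
  have s2 := PartrecToTM2.tr_supports c .halt
  have s1 := TM2to1.tr_supports _ s2
  have s0 := TM1to0.tr_supports _ s1
  set M₀ := TM1to0.tr (TM2to1.tr PartrecToTM2.tr) with hM₀
  set S := TM1to0.trStmts (TM2to1.tr PartrecToTM2.tr)
    (TM2to1.trSupp PartrecToTM2.tr (PartrecToTM2.codeSupp c .halt)) with hS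
  let Q := {q // q ∈ S}
  let iQ : Inhabited Q := ⟨⟨default, s0.1⟩⟩
  let g₁ : PointedMap (TM1to0.Λ' (TM2to1.tr PartrecToTM2.tr)) Q :=
    ⟨fun q => if h : q ∈ S then ⟨q, h⟩ else default, by
      rw [dif_pos (Finset.mem_coe.1 s0.1)]; rfl⟩
  let G := TM2to1.Γ' PartrecToTM2.K' (fun _ => PartrecToTM2.Γ')
  let idG : PointedMap G G := ⟨id, rfl⟩
  -- States outside the finite support are sent to the default state. This is harmless, since a run
  -- from the start state never leaves the support.
  let M : TM0.Machine G Q := TM0.Machine.map M₀ idG idG g₁ Subtype.val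
  have hresp := TM0.Machine.map_respects M₀ idG idG g₁ Subtype.val s0 (fun _ => rfl)
    (fun q hq => congrArg Subtype.val (dif_pos (Finset.mem_coe.1 hq)))
  let e : PartrecToTM2.Γ' → G := fun a =>
    (false, Function.update (fun _ => none) PartrecToTM2.K'.main (some a))
  let bit : Bool → PartrecToTM2.Γ' := fun b => bif b then .bit1 else .bit0
  -- The stack for `[n]` is the digits followed by `cons`. Reversed, `cons` comes first and lies in
  -- the bottom cell, which is marked by `true`.
  let g₀ : G := (true, Function.update (fun _ => none) PartrecToTM2.K'.main (some .cons))
  refine ⟨G, Q, inferInstance, inferInstance, iQ, inferInstance, M, g₀, fun b => e (bit b), ?_⟩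
  suffices key : ∀ n : ℕ, (StateTransition.eval (TM0.step M)
      (TM0.init (g₀ :: n.bits.reverse.map fun b => e (bit b)))).Dom ↔ (c.eval [n]).Dom by
    rwa [funext fun n => propext (key n)]
  intro n
  set l : List G := TM2to1.trInit PartrecToTM2.K'.main (PartrecToTM2.trList [n]) with hl
  have hl' : l = g₀ :: n.bits.reverse.map (fun b => e (bit b)) := by
    have hr : (PartrecToTM2.trList [n]).reverse =
        PartrecToTM2.Γ'.cons :: n.bits.reverse.map bit := by
      simp [trNat_eq_bits, bit]
    rw [hl]
    unfold TM2to1.trInit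
    rw [hr]
    exact congrArg (g₀ :: ·) List.map_map
  rw [← hl']
  have h0 := StateTransition.tr_eval_dom hresp (a₁ := TM0.init l) (a₂ := TM0.init l)
    ⟨s0.1, by rw [TM0.map_init]; exact congrArg _ (List.map_id l)⟩
  have h1 : (TM0.eval M₀ l).Dom ↔ (StateTransition.eval (TM0.step M₀) (TM0.init l)).Dom := Iff.rfl
  have h2 : (TM0.eval M₀ l).Dom ↔ (TM1.eval (TM2to1.tr PartrecToTM2.tr) l).Dom := by
    rw [TM1to0.tr_eval]
  have h3 := TM2to1.tr_eval_dom PartrecToTM2.tr PartrecToTM2.K'.main (PartrecToTM2.trList [n])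
  have h4 : (TM2.init PartrecToTM2.K'.main (PartrecToTM2.trList [n]) :
      TM2.Cfg (fun _ : PartrecToTM2.K' => PartrecToTM2.Γ') PartrecToTM2.Λ'
        (Option PartrecToTM2.Γ')) = PartrecToTM2.init c [n] := by
    unfold TM2.init PartrecToTM2.init
    congr 1
    funext k
    cases k <;> rfl
  have h5 : (TM2.eval PartrecToTM2.tr PartrecToTM2.K'.main (PartrecToTM2.trList [n])).Dom ↔
      (c.eval [n]).Dom := by
    have := PartrecToTM2.tr_eval c [n]
    unfold TM2.eval
    rw [h4, this]
    rfl
  exact h0.trans (h1.symm.trans (h2.trans (h3.trans h5)))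

/-! ### Derived MTL operators -/

namespace Interval

/-- `[0, ∞)` -/
def all : Interval := ⟨0, true, none, false⟩

/-- `(0, ∞)` -/
def pos : Interval := ⟨0, false, none, false⟩

/-- `[1, ∞)` -/
def geOne : Interval := ⟨1, true, none, false⟩

/-- `[1, 1]` -/
def one : Interval := ⟨1, true, some 1, true⟩

theorem mem_all {d : ℝ} : d ∈ all.toSet ↔ 0 ≤ d := by simp [all, toSet]

theorem mem_pos {d : ℝ} : d ∈ pos.toSet ↔ 0 < d := by simp [pos, toSet]

theorem mem_geOne {d : ℝ} : d ∈ geOne.toSet ↔ 1 ≤ d := by simp [geOne, toSet]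

theorem mem_one {d : ℝ} : d ∈ one.toSet ↔ d = 1 := by
  simp only [one, toSet, if_true, Option.mem_def, Option.some.injEq, Set.mem_ofPred_eq,
    Nat.cast_one, forall_eq']
  exact ⟨fun h => le_antisymm h.2 h.1, fun h => ⟨h.ge, h.le⟩⟩

end Interval

namespace MTL

variable {σ : Type}

/-- The until is strict, so a false left argument leaves no room for a position in between. -/
def nextIn (I : Interval) (φ : MTL σ) : MTL σ := untl I (neg tt) φ

def next (φ : MTL σ) : MTL σ := nextIn .all φ

def finallyIn (I : Interval) (φ : MTL σ) : MTL σ := untl I tt φ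

def imp (φ ψ : MTL σ) : MTL σ := neg (and φ (neg ψ))

/-- `φ` holds now and at all later positions. -/
def globally (φ : MTL σ) : MTL σ := and φ (neg (finallyIn .all (neg φ)))

def conj (l : List (MTL σ)) : MTL σ := l.foldr and tt

open Classical in
/-- The current letter has the property `p`. -/
noncomputable def letter [Fintype σ] (p : σ → Prop) : MTL σ :=
  neg (conj (((Finset.univ.filter p).toList).map fun a => neg (atom a)))

variable {w : List (σ × ℝ≥0)}

theorem sat_imp {φ ψ : MTL σ} {i : Fin w.length} :
    (imp φ ψ).Sat w i ↔ (φ.Sat w i → ψ.Sat w i) := by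
  simp [imp, Sat]

theorem sat_conj {l : List (MTL σ)} {i : Fin w.length} :
    (conj l).Sat w i ↔ ∀ φ ∈ l, φ.Sat w i := by
  induction l with
  | nil => simp [conj, Sat]
  | cons φ l ih =>
    have : conj (φ :: l) = and φ (conj l) := rfl
    simp [this, Sat, ih]

theorem sat_letter [Fintype σ] {p : σ → Prop} {i : Fin w.length} :
    (letter p).Sat w i ↔ p (w.get i).1 := by
  simp only [letter, Sat, sat_conj, List.mem_map, Finset.mem_toList, Finset.mem_filter,
    Finset.mem_univ, true_and, forall_exists_index, and_imp, forall_apply_eq_imp_iff₂, not_forall,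
    not_not]
  exact ⟨fun ⟨a, ha, h⟩ => h ▸ ha, fun h => ⟨_, h, rfl⟩⟩

theorem sat_nextIn {I : Interval} {φ : MTL σ} {i : ℕ} {hi : i < w.length} :
    (nextIn I φ).Sat w ⟨i, hi⟩ ↔ ∃ h : i + 1 < w.length, φ.Sat w ⟨i + 1, h⟩ ∧
      ((w[i + 1].2 : ℝ) - (w[i].2 : ℝ) ∈ I.toSet) := by
  simp only [nextIn, Sat, not_true_eq_false]
  constructor
  · rintro ⟨⟨j, hj⟩, hij, h1, h2, h3⟩
    have hij' : i < j := hij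
    obtain rfl : j = i + 1 := by
      by_contra hne
      exact h3 ⟨i + 1, by omega⟩ (Nat.lt_succ_self i) (show i + 1 < j by omega)
    exact ⟨hj, h1, h2⟩
  · rintro ⟨h, h1, h2⟩
    refine ⟨⟨i + 1, h⟩, Nat.lt_succ_self i, h1, h2, fun ⟨k, _⟩ hk hk' => ?_⟩
    have h3 : i < k := hk
    have h4 : k < i + 1 := hk'
    omega

theorem sat_finallyIn {I : Interval} {φ : MTL σ} {i : ℕ} {hi : i < w.length} :
    (finallyIn I φ).Sat w ⟨i, hi⟩ ↔ ∃ j, ∃ h : j < w.length, i < j ∧ φ.Sat w ⟨j, h⟩ ∧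
      ((w[j].2 : ℝ) - (w[i].2 : ℝ) ∈ I.toSet) := by
  simp only [finallyIn, Sat, implies_true, and_true]
  constructor
  · rintro ⟨⟨j, hj⟩, hij, h1, h2⟩
    exact ⟨j, hj, hij, h1, h2⟩
  · rintro ⟨j, hj, hij, h1, h2⟩
    exact ⟨⟨j, hj⟩, hij, h1, h2⟩

theorem sat_next (hw : (w.map Prod.snd).Pairwise (· ≤ ·)) {φ : MTL σ} {i : ℕ}
    {hi : i < w.length} :
    (next φ).Sat w ⟨i, hi⟩ ↔ ∃ h : i + 1 < w.length, φ.Sat w ⟨i + 1, h⟩ := by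
  rw [next, sat_nextIn]
  refine exists_congr fun h => and_iff_left ?_
  have := List.pairwise_iff_getElem.1 hw i (i + 1) (by simpa using hi) (by simpa using h)
    (Nat.lt_succ_self i)
  simp only [List.getElem_map] at this
  rw [Interval.mem_all]
  exact sub_nonneg.2 (by exact_mod_cast this)

theorem sat_untl_all (hw : (w.map Prod.snd).Pairwise (· ≤ ·)) {φ ψ : MTL σ} {i : ℕ}
    {hi : i < w.length} :
    (untl .all φ ψ).Sat w ⟨i, hi⟩ ↔ ∃ j, ∃ h : j < w.length, i < j ∧ ψ.Sat w ⟨j, h⟩ ∧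
      ∀ k (h' : k < j), i < k → φ.Sat w ⟨k, h'.trans h⟩ := by
  simp only [Sat]
  constructor
  · rintro ⟨⟨j, hj⟩, hij, h1, -, h2⟩
    exact ⟨j, hj, hij, h1, fun k hk hik => h2 ⟨k, hk.trans hj⟩ hik hk⟩
  · rintro ⟨j, hj, hij, h1, h2⟩
    refine ⟨⟨j, hj⟩, hij, h1, ?_, fun k hik hk => h2 k hk hik⟩
    have := List.pairwise_iff_getElem.1 hw i j (by simpa using hi) (by simpa using hj) hij
    simp only [List.getElem_map] at this
    rw [Interval.mem_all]
    exact sub_nonneg.2 (by exact_mod_cast this)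

theorem sat_globally (hw : (w.map Prod.snd).Pairwise (· ≤ ·)) {φ : MTL σ} {i : ℕ}
    {hi : i < w.length} :
    (globally φ).Sat w ⟨i, hi⟩ ↔ ∀ j, ∀ h : j < w.length, i ≤ j → φ.Sat w ⟨j, h⟩ := by
  simp only [globally, Sat, sat_finallyIn, not_exists, not_and]
  constructor
  · rintro ⟨h1, h2⟩ j hj hij
    rcases hij.eq_or_lt with rfl | hlt
    · exact h1
    · by_contra hn
      refine h2 j hj hlt hn ?_
      have := List.pairwise_iff_getElem.1 hw i j (by simpa using hi) (by simpa using hj) hlt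
      simp only [List.getElem_map] at this
      rw [Interval.mem_all]
      exact sub_nonneg.2 (by exact_mod_cast this)
  · intro h
    exact ⟨h i hi le_rfl, fun j hj hij hn => absurd (h j hj hij.le) hn⟩

end MTL

/-! ### A formula describing computations without insertion errors -/

namespace MTL

variable {σ : Type}

/-- The letters of `l` follow immediately after the current position, and `φ` holds at the last of
them. -/
def chain (φ : MTL σ) (l : List σ) : MTL σ := l.foldr (fun a ψ => next (and (atom a) ψ)) φ

theorem sat_chain {w : List (σ × ℝ≥0)} (hw : (w.map Prod.snd).Pairwise (· ≤ ·)) {u : ℕ → σ}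
    (hu : ∀ i (h : i < w.length), w[i].1 = u i) {φ : MTL σ} {P : ℕ → Prop}
    (hφ : ∀ i (h : i < w.length), φ.Sat w ⟨i, h⟩ ↔ P i) (l : List σ) {i : ℕ}
    {hi : i < w.length} :
    (chain φ l).Sat w ⟨i, hi⟩ ↔ i + l.length < w.length ∧
      (∀ k (hk : k < l.length), u (i + 1 + k) = l[k]) ∧ P (i + l.length) := by
  induction l generalizing i with
  | nil => simp [chain, hφ, hi]
  | cons a l ih =>
    have : chain φ (a :: l) = next (and (atom a) (chain φ l)) := rfl
    rw [this, sat_next hw]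
    simp only [Sat, ih, List.length_cons, List.get_eq_getElem, hu]
    have e1 : i + 1 + l.length = i + (l.length + 1) := by omega
    rw [e1]
    constructor
    · rintro ⟨h, h1, h2, h3, h4⟩
      refine ⟨h2, fun k hk => ?_, h4⟩
      rcases k with _ | k
      · simpa using h1
      · have := h3 k (by omega)
        rw [show i + 1 + (k + 1) = i + 1 + 1 + k by omega]
        simpa using this
    · rintro ⟨h2, h3, h4⟩
      refine ⟨by omega, by simpa using h3 0 (by omega), h2, fun k hk => ?_, h4⟩
      have := h3 (k + 1) (by omega)
      rw [show i + 1 + (k + 1) = i + 1 + 1 + k by omega] at this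
      simpa using this

end MTL

/-- Data for a system of rows of equal length: a separator, a blank, admissible windows consisting
of three consecutive letters and the letter below the middle one, and the final letters. -/
structure RowSystem (A : Type) where
  sep : A
  blank : A
  window : A → A → A → A → Prop
  halt : A → Prop

namespace RowSystem

variable {σ A : Type} (S : RowSystem A) (e : σ ≃ SymbolKind × A)

/-- The sequence `u` of letters with time stamps `τ` has length `m`, its calls spell the initial
row with input `l`, and it is locally consistent. -/
structure IsEncoding (l : List A) (u : ℕ → σ) (τ : ℕ → ℝ≥0) (m : ℕ) : Prop where
  strictMono : ∀ i, i + 1 < m → τ i < τ (i + 1)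
  call_of_call_succ : ∀ i, i + 1 < m → (e (u (i + 1))).1 = .call → (e (u i)).1 = .call
  ret_succ_of_ret : ∀ i, i + 1 < m → (e (u i)).1 = .ret → (e (u (i + 1))).1 = .ret
  not_call : ∀ i, 0 < i → i < m → τ 0 + 1 ≤ τ i → (e (u i)).1 ≠ .call
  exists_later : ∀ i, i < m → (e (u i)).1 ≠ .ret → ∃ j, i < j ∧ j < m ∧ τ j = τ i + 1
  window : ∀ i j, i + 2 < m → i + 1 < j → j < m → τ j = τ (i + 1) + 1 →
    S.window (e (u i)).2 (e (u (i + 1))).2 (e (u (i + 2))).2 (e (u j)).2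
  sep : ∀ i j, i < j → j < m → τ j = τ i + 1 → (e (u i)).2 = S.sep → (e (u j)).2 = S.sep
  halt : ∃ i, 0 < i ∧ i < m ∧ S.halt (e (u i)).2 ∧ (e (u i)).1 ≠ .ret
  zero : u 0 = e.symm (.call, S.sep)
  first_row : ∃ h N, 0 < h ∧ h + l.length < N + 1 ∧ N < m ∧
    (∀ i, 0 < i → i < h → u i = e.symm (.call, S.blank)) ∧
    (∀ k (hk : k < l.length), u (h + k) = e.symm (.call, l[k])) ∧
    (∀ i, h + l.length ≤ i → i < N → u i = e.symm (.call, S.blank)) ∧ (e (u N)).1 ≠ .call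

open MTL Classical

variable [Fintype σ]

noncomputable def kindF (k : SymbolKind) : MTL σ := letter fun s => (e s).1 = k

noncomputable def labelF (a : A) : MTL σ := letter fun s => (e s).2 = a

/-- Blank calls until the first letter that is not a call. -/
noncomputable def blankTail : MTL σ :=
  untl .all (atom (e.symm (.call, S.blank))) (neg (kindF e .call))

/-- The first row consists of a separator, blanks, the input `a :: l` and blanks. -/
noncomputable def firstRow (a : A) (l : List A) : MTL σ :=
  untl .all (atom (e.symm (.call, S.blank)))
    (and (atom (e.symm (.call, a)))
      (chain (S.blankTail e) (l.map fun b => e.symm (.call, b))))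

variable {w : List (σ × ℝ≥0)} {u : ℕ → σ} {τ : ℕ → ℝ≥0}

/-- The start `h` of the input and the end `N` of the row remain existential: one formula serves
computations of every space bound. -/
theorem sat_firstRow (hw : (w.map Prod.snd).Pairwise (· ≤ ·))
    (hu : ∀ i (h : i < w.length), w[i] = (u i, τ i)) {h0 : 0 < w.length} (a : A) (l : List A) :
    (S.firstRow e a l).Sat w ⟨0, h0⟩ ↔
      ∃ h N, 0 < h ∧ h + (a :: l).length < N + 1 ∧ N < w.length ∧
        (∀ i, 0 < i → i < h → u i = e.symm (.call, S.blank)) ∧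
        (∀ k (hk : k < (a :: l).length), u (h + k) = e.symm (.call, (a :: l)[k])) ∧
        (∀ i, h + (a :: l).length ≤ i → i < N → u i = e.symm (.call, S.blank)) ∧
        (e (u N)).1 ≠ .call := by
  have htail : ∀ i (h : i < w.length), (S.blankTail e).Sat w ⟨i, h⟩ ↔
      ∃ N, i < N ∧ N < w.length ∧ (∀ k, i < k → k < N → u k = e.symm (.call, S.blank)) ∧
        (e (u N)).1 ≠ .call := by
    intro i h
    simp only [blankTail, sat_untl_all hw, kindF, Sat, sat_letter, List.get_eq_getElem, hu]
    constructor
    · rintro ⟨N, h1, h2, h3, h4⟩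
      exact ⟨N, h2, h1, fun k hk hk' => h4 k hk' hk, h3⟩
    · rintro ⟨N, h2, h1, h4, h3⟩
      exact ⟨N, h1, h2, h3, fun k hk hk' => h4 k hk' hk⟩
  simp only [firstRow, sat_untl_all hw, sat_chain hw (fun i h => congrArg Prod.fst (hu i h)) htail,
    Sat, List.get_eq_getElem, hu, List.length_map, List.getElem_map]
  constructor
  · rintro ⟨h, h1, h2, ⟨h3, h4, h5, N, h6, h7, h8, h9⟩, h10⟩
    refine ⟨h, N, h2, by simp; omega, h7, fun i hi hi' => h10 i hi' hi, ?_,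
      fun i hi hi' => h8 i (by simp at hi; omega) hi', h9⟩
    intro k hk
    rcases k with _ | k
    · simpa using h3
    · rw [show h + (k + 1) = h + 1 + k by omega]
      exact h5 k (by simpa using hk)
  · rintro ⟨h, N, h2, h6, h7, h10, h5, h8, h9⟩
    simp only [List.length_cons] at h6 h8 h5
    refine ⟨h, by omega, h2, ⟨by simpa using h5 0 (by omega), by omega, fun k hk => ?_, N,
      by omega, h7, fun k hk hk' => h8 k (by omega) hk', h9⟩, fun k hk hk' => h10 k hk' hk⟩
    have := h5 (k + 1) (by omega)
    rw [show h + (k + 1) = h + 1 + k by omega] at this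
    simpa using this

variable [Fintype A]

/-- The conditions on the word that do not depend on the input. -/
noncomputable def consistent : MTL σ :=
  conj [globally (imp (next tt) (nextIn .pos tt)),
    globally (imp (next (kindF e .call)) (kindF e .call)),
    globally (imp (kindF e .ret) (neg (next (neg (kindF e .ret))))),
    neg (finallyIn .geOne (kindF e .call)),
    globally (imp (neg (kindF e .ret)) (finallyIn .one tt)),
    globally (conj (((Finset.univ : Finset (A × A × A × A)).filter
      fun q => ¬ S.window q.1 q.2.1 q.2.2.1 q.2.2.2).toList.map fun q =>
        neg (and (labelF e q.1) (next (and (labelF e q.2.1)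
          (and (next (labelF e q.2.2.1)) (finallyIn .one (labelF e q.2.2.2)))))))),
    globally (imp (labelF e S.sep) (neg (finallyIn .one (neg (labelF e S.sep))))),
    finallyIn .all (and (letter fun s => S.halt (e s).2) (neg (kindF e .ret))),
    atom (e.symm (.call, S.sep))]

noncomputable def formula (a : A) (l : List A) : MTL σ :=
  and (S.consistent e) (S.firstRow e a l)

theorem sat_consistent (hw : (w.map Prod.snd).Pairwise (· ≤ ·))
    (hu : ∀ i (h : i < w.length), w[i] = (u i, τ i)) {h0 : 0 < w.length} :
    (S.consistent e).Sat w ⟨0, h0⟩ ↔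
      (∀ i, i + 1 < w.length → τ i < τ (i + 1)) ∧
      (∀ i, i + 1 < w.length → (e (u (i + 1))).1 = .call → (e (u i)).1 = .call) ∧
      (∀ i, i + 1 < w.length → (e (u i)).1 = .ret → (e (u (i + 1))).1 = .ret) ∧
      (∀ i, 0 < i → i < w.length → τ 0 + 1 ≤ τ i → (e (u i)).1 ≠ .call) ∧
      (∀ i, i < w.length → (e (u i)).1 ≠ .ret →
        ∃ j, i < j ∧ j < w.length ∧ τ j = τ i + 1) ∧
      (∀ i j, i + 2 < w.length → i + 1 < j → j < w.length → τ j = τ (i + 1) + 1 →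
        S.window (e (u i)).2 (e (u (i + 1))).2 (e (u (i + 2))).2 (e (u j)).2) ∧
      (∀ i j, i < j → j < w.length → τ j = τ i + 1 → (e (u i)).2 = S.sep →
        (e (u j)).2 = S.sep) ∧
      (∃ i, 0 < i ∧ i < w.length ∧ S.halt (e (u i)).2 ∧ (e (u i)).1 ≠ .ret) ∧
      u 0 = e.symm (.call, S.sep) := by
  have hone : ∀ i j, (τ j : ℝ) - (τ i : ℝ) = 1 ↔ τ j = τ i + 1 := by
    intro i j
    rw [sub_eq_iff_eq_add, add_comm, ← NNReal.coe_one, ← NNReal.coe_add, NNReal.coe_inj]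
  have hge : ∀ i j, 1 ≤ (τ j : ℝ) - (τ i : ℝ) ↔ τ i + 1 ≤ τ j := by
    intro i j
    rw [le_sub_iff_add_le, add_comm, ← NNReal.coe_one, ← NNReal.coe_add, NNReal.coe_le_coe]
  have hle : ∀ i j, i < j → j < w.length → (0 : ℝ) ≤ (τ j : ℝ) - (τ i : ℝ) := by
    intro i j hij hj
    have := List.pairwise_iff_getElem.1 hw i j (by simp; omega) (by simpa using hj) hij
    simp only [List.getElem_map, hu] at this
    exact sub_nonneg.2 (by exact_mod_cast this)
  have hpos : ∀ i j, (0 : ℝ) < (τ j : ℝ) - (τ i : ℝ) ↔ τ i < τ j := by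
    intro i j
    rw [sub_pos, NNReal.coe_lt_coe]
  unfold consistent
  rw [sat_conj]
  simp only [List.mem_cons, List.not_mem_nil, or_false, forall_eq_or_imp, forall_eq]
  refine and_congr ?_ (and_congr ?_ (and_congr ?_ (and_congr ?_ (and_congr ?_ (and_congr ?_
    (and_congr ?_ (and_congr ?_ ?_)))))))
  · simp only [sat_globally hw, sat_imp, sat_next hw, sat_nextIn, Sat, hu, Interval.mem_pos, hpos]
    exact ⟨fun h i hi => (h i (by omega) (by omega) ⟨hi, trivial⟩).2.2,
      fun h i hi _ ⟨h1, _⟩ => ⟨h1, trivial, h i h1⟩⟩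
  · simp only [sat_globally hw, sat_imp, sat_next hw, kindF, sat_letter, List.get_eq_getElem, hu]
    exact ⟨fun h i hi hc => h i (by omega) (by omega) ⟨hi, hc⟩, fun h i _ _ ⟨h1, h2⟩ => h i h1 h2⟩
  · simp only [sat_globally hw, sat_imp, sat_next hw, kindF, Sat, sat_letter, List.get_eq_getElem,
      hu, not_exists, not_not]
    exact ⟨fun h i hi hc => h i (by omega) (by omega) hc hi, fun h i _ _ h1 h2 => h i h2 h1⟩
  · simp only [sat_finallyIn, kindF, Sat, sat_letter, List.get_eq_getElem, hu, Interval.mem_geOne,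
      hge, not_exists, not_and]
    exact ⟨fun h i h1 h2 h3 h4 => h i h2 h1 h4 h3, fun h i h2 h1 h4 h3 => h i h1 h2 h3 h4⟩
  · simp only [sat_globally hw, sat_imp, sat_finallyIn, kindF, Sat, sat_letter,
      List.get_eq_getElem, hu, Interval.mem_one, hone, true_and]
    constructor
    · intro h i hi hr
      obtain ⟨j, h1, h2, h3⟩ := h i hi (by omega) hr
      exact ⟨j, h2, h1, h3⟩
    · intro h i hi _ hr
      obtain ⟨j, h2, h1, h3⟩ := h i hi hr
      exact ⟨j, h1, h2, h3⟩
  · simp only [sat_globally hw, sat_conj, sat_next hw, sat_finallyIn, labelF, List.mem_map,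
      Finset.mem_toList, Finset.mem_filter, Finset.mem_univ, true_and, forall_exists_index, and_imp,
      forall_apply_eq_imp_iff₂, Sat, sat_letter, List.get_eq_getElem, hu,
      Interval.mem_one, hone, not_and, not_exists]
    constructor
    · intro h i j hi hij hj ht
      by_contra hn
      exact h i (by omega) (by omega) (_, _, _, _) hn rfl (by omega) rfl hi rfl j hj hij rfl ht
    · rintro h i hi _ ⟨a, b, c, d⟩ hn rfl h1 rfl h2 rfl j hj hij rfl ht
      exact hn (h i j h2 hij hj ht)
  · simp only [sat_globally hw, sat_imp, sat_finallyIn, labelF, Sat, sat_letter,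
      List.get_eq_getElem, hu, Interval.mem_one, hone, not_exists, not_and]
    constructor
    · intro h i j hij hj ht hs
      by_contra hn
      exact h i (by omega) (by omega) hs j hj hij hn ht
    · intro h i hi _ hs j hj hij hn ht
      exact hn (h i j hij hj ht hs)
  · simp only [sat_finallyIn, kindF, Sat, sat_letter, List.get_eq_getElem, hu, Interval.mem_all]
    constructor
    · rintro ⟨j, h1, h2, h3, -⟩
      exact ⟨j, h2, h1, h3⟩
    · rintro ⟨j, h2, h1, h3⟩
      exact ⟨j, h1, h2, h3, hle 0 j h2 h1⟩
  · simp only [Sat, List.get_eq_getElem, hu]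

theorem sat_formula (hw : (w.map Prod.snd).Pairwise (· ≤ ·))
    (hu : ∀ i (h : i < w.length), w[i] = (u i, τ i)) {h0 : 0 < w.length} (a : A) (l : List A) :
    (S.formula e a l).Sat w ⟨0, h0⟩ ↔ S.IsEncoding e (a :: l) u τ w.length := by
  simp only [formula, Sat, S.sat_consistent e hw hu, S.sat_firstRow e hw hu]
  constructor
  · rintro ⟨⟨h1, h2, h3, h4, h5, h6, h7, h8, h9⟩, h10⟩
    exact ⟨h1, h2, h3, h4, h5, h6, h7, h8, h9, h10⟩
  · rintro ⟨h1, h2, h3, h4, h5, h6, h7, h8, h9, h10⟩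
    exact ⟨⟨h1, h2, h3, h4, h5, h6, h7, h8, h9⟩, h10⟩

end RowSystem

/-! ### The counter net -/

/-- The operation determined by the kind of a symbol. -/
def TimedPDA.SymbolKind.op : SymbolKind → StackOp (Fin 1)
  | .internal => .noop
  | .call => .push 0
  | .ret => .pop 0

section CounterNet

variable {σ : Type} [Fintype σ] (kind : σ → SymbolKind)

open Classical in
/-- A single location with one loop for every letter. -/
noncomputable def counterNet : TimedPDA σ (Fin 1) (Fin 1) (Fin 0) where
  init := {0}
  final := {0}
  edges := Finset.univ.image fun a => ⟨0, a, [], (kind a).op, ∅, 0⟩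

theorem mem_edges_counterNet {ed : Edge σ (Fin 1) (Fin 1) (Fin 0)} :
    ed ∈ (counterNet kind).edges ↔ ∃ a, ⟨0, a, [], (kind a).op, ∅, 0⟩ = ed := by
  simp [counterNet]

theorem counterNet_isVisiblyOneCounterNet : (counterNet kind).IsVisiblyOneCounterNet := by
  refine ⟨by simp [IsOneCounter], ?_, kind, ?_⟩
  · intro ed hed
    obtain ⟨a, rfl⟩ := (mem_edges_counterNet kind).1 hed
    dsimp only
    cases kind a <;> simp [SymbolKind.op]
  · intro ed hed
    obtain ⟨a, rfl⟩ := (mem_edges_counterNet kind).1 hed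
    dsimp only
    cases kind a <;> simp [SymbolKind.op]

theorem counterNet_hasNoClocks : (counterNet kind).HasNoClocks :=
  inferInstanceAs (IsEmpty (Fin 0))

theorem counterNet_isDeterministic : (counterNet kind).IsDeterministic := by
  intro ed hed ed' hed' _ h hne
  obtain ⟨a, rfl⟩ := (mem_edges_counterNet kind).1 hed
  obtain ⟨b, rfl⟩ := (mem_edges_counterNet kind).1 hed'
  obtain rfl : a = b := h
  exact absurd rfl hne

theorem counterNet_step {s s' : State (Fin 1) (Fin 1) (Fin 0)} {δ : ℝ≥0} {a : σ} :
    (counterNet kind).Step s δ a s' ↔ (kind a).op.Rel s.stack s'.stack := by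
  constructor
  · rintro ⟨ed, hed, -, rfl, -, -, -, h⟩
    obtain ⟨a, rfl⟩ := (mem_edges_counterNet kind).1 hed
    exact h
  · intro h
    exact ⟨_, (mem_edges_counterNet kind).2 ⟨a, rfl⟩, Subsingleton.elim _ _, rfl,
      Subsingleton.elim _ _, by simp [ClockConstraint.Holds], fun x => x.elim0, h⟩

open Classical in
-- The stack height plus the number of returns read equals the initial height plus the number of
-- calls read, since each letter changes the height by its kind.
theorem counterNet_run_count {t : ℝ≥0} {s s' : State (Fin 1) (Fin 1) (Fin 0)}
    {w : List (σ × ℝ≥0)} (h : (counterNet kind).Run t s w s') :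
    s.stack.length + w.countP (fun x => kind x.1 = .call) =
      s'.stack.length + w.countP (fun x => kind x.1 = .ret) := by
  induction h with
  | nil => simp
  | @cons t δ s s' s'' a w hs _ ih =>
    rw [counterNet_step] at hs
    simp only [List.countP_cons]
    cases hk : kind a <;> rw [hk] at hs <;> simp only [SymbolKind.op, StackOp.Rel] at hs <;>
      rw [hs] at * <;> simp at * <;> omega

/-- Before position `i` the stack has height `min i N - (i - M)`: calls read minus returns read. The
bound `m ≤ M + N` keeps it positive at every return, so no pop is blocked. -/
theorem counterNet_run_exists {u : ℕ → σ} {τ : ℕ → ℝ≥0} {N M m : ℕ}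
    (hτ : ∀ i, i + 1 < m → τ i ≤ τ (i + 1)) (hcall : ∀ i, i < m → (kind (u i) = .call ↔ i < N))
    (hret : ∀ i, i < m → (kind (u i) = .ret ↔ M ≤ i)) (hm : m ≤ M + N) (d : ℕ) :
    ∀ (i : ℕ) (t : ℝ≥0) (s : State (Fin 1) (Fin 1) (Fin 0)), i + d = m → (i < m → t ≤ τ i) →
      s.stack = List.replicate (min i N - (i - M)) 0 →
      ∃ s', (counterNet kind).Run t s ((List.range' i d).map fun k => (u k, τ k)) s' := by
  induction d with
  | zero => exact fun i t s _ _ _ => ⟨s, Run.nil t s⟩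
  | succ d ih =>
    intro i t s hi ht hs
    have hi' : i < m := by omega
    have hc := hcall i hi'
    have hr := hret i hi'
    obtain ⟨s', hs'⟩ := ih (i + 1) (τ i)
      ⟨0, s.val, List.replicate (min (i + 1) N - (i + 1 - M)) 0⟩ (by omega) (hτ i) rfl
    refine ⟨s', ?_⟩
    have hstep : (counterNet kind).Step s (τ i - t) (u i)
        ⟨0, s.val, List.replicate (min (i + 1) N - (i + 1 - M)) 0⟩ := by
      rw [counterNet_step, hs]
      cases hk : kind (u i) <;> simp only [hk, reduceCtorEq, false_iff, true_iff] at hc hr <;>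
        simp only [SymbolKind.op, StackOp.Rel]
      · congr 1; omega
      · rw [← List.replicate_succ]
        congr 1; omega
      · rw [← List.replicate_succ]
        congr 1; omega
    have e : t + (τ i - t) = τ i := add_tsub_cancel_of_le (ht hi')
    have := Run.cons (A := counterNet kind) (t := t) hstep (e.symm ▸ hs')
    rw [e] at this
    exact this

open Classical in
theorem countP_of_iff_lt {α : Type} {p : α → Prop} {w : List α} {N : ℕ} (hN : N ≤ w.length)
    (h : ∀ i (hi : i < w.length), p w[i] ↔ i < N) : w.countP (fun x => p x) = N := by
  rw [← List.take_append_drop N w, List.countP_append, List.countP_eq_length.2,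
    List.countP_eq_zero.2]
  · simpa using hN
  · intro a ha
    obtain ⟨i, hi, rfl⟩ := List.mem_iff_getElem.1 ha
    simp only [List.length_drop] at hi
    simp only [List.getElem_drop, h, decide_eq_true_eq]
    omega
  · intro a ha
    obtain ⟨i, hi, rfl⟩ := List.mem_iff_getElem.1 ha
    simp only [List.length_take] at hi
    simp only [List.getElem_take, h, decide_eq_true_eq]
    omega

/-- In a word accepted by the counter net, there are at most as many returns as calls. -/
theorem length_le_of_mem_language {w : TimedWord σ} (hw : w ∈ (counterNet kind).language)
    {u : ℕ → σ} (hu : ∀ i (h : i < w.1.length), w.1[i].1 = u i) {N M : ℕ}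
    (hN : N ≤ w.1.length) (hM : M ≤ w.1.length)
    (hcall : ∀ i, i < w.1.length → (kind (u i) = .call ↔ i < N))
    (hret : ∀ i, i < w.1.length → (kind (u i) = .ret ↔ M ≤ i)) : w.1.length ≤ M + N := by
  classical
  obtain ⟨s, s', -, -, hs, -, hrun⟩ := hw
  have h1 := counterNet_run_count kind hrun
  have h2 := countP_of_iff_lt (p := fun x : σ × ℝ≥0 => kind x.1 = .call) hN
    (fun i hi => by rw [hu i hi]; exact hcall i hi)
  have h3 := countP_of_iff_lt (p := fun x : σ × ℝ≥0 => ¬ kind x.1 = .ret) hM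
    (fun i hi => by rw [hu i hi, hret i hi, not_le])
  have h4 := List.length_eq_countP_add_countP (fun x : σ × ℝ≥0 => decide (kind x.1 = .ret)) (l := w.1)
  simp only [decide_eq_true_eq] at h4
  rw [hs, h2] at h1
  simp only [List.length_nil] at h1
  have h5 : w.1.countP (fun x => decide (¬ decide (kind x.1 = .ret) = true)) = M := by
    rw [← h3]; congr 1; funext x; simp
  simp at h5 h4
  omega

end CounterNet

/-! ### Absence of insertion errors -/

namespace RowSystem

variable {σ A : Type} {S : RowSystem A} {e : σ ≃ SymbolKind × A} {l : List A} {u : ℕ → σ}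
  {τ : ℕ → ℝ≥0} {m : ℕ}

/-- Applied to "is a call" and to "is not a return": both hold on an initial segment of the word. -/
theorem exists_threshold {p : ℕ → Prop} {m : ℕ} (h : ∀ i, i + 1 < m → p (i + 1) → p i) :
    ∃ M ≤ m, ∀ i, i < m → (p i ↔ i < M) := by
  induction m with
  | zero => exact ⟨0, le_rfl, fun i hi => absurd hi (by omega)⟩
  | succ m ih =>
    obtain ⟨M, hM, hp⟩ := ih fun i hi => h i (by omega)
    by_cases hm : p m
    · refine ⟨m + 1, le_rfl, fun i hi => ⟨fun _ => hi, fun _ => ?_⟩⟩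
      obtain ⟨d, rfl⟩ : ∃ d, m = i + d := ⟨m - i, by omega⟩
      clear hi hp hM ih
      induction d with
      | zero => exact hm
      | succ d ihd =>
        exact ihd (fun j hj => h j (by omega)) (h _ (by omega) hm) (by omega)
    · refine ⟨M, by omega, fun i hi => ?_⟩
      rcases Nat.lt_succ_iff_lt_or_eq.1 hi with hi | rfl
      · exact hp i hi
      · exact ⟨fun hp' => absurd hp' hm, fun hi => absurd hi (by omega)⟩

theorem IsEncoding.strictMonoOn (h : S.IsEncoding e l u τ m) {i j : ℕ} (hij : i < j)
    (hj : j < m) : τ i < τ j := by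
  induction j, hij using Nat.le_induction with
  | base => exact h.strictMono i hj
  | succ j hij ih => exact (ih (by omega)).trans (h.strictMono j hj)

/-- The letter one time unit later is the letter `N` positions later, where `N` is the number of
calls, provided that there are at most `N` returns. -/
theorem IsEncoding.later_eq (h : S.IsEncoding e l u τ m)
    (hcount : ∀ N M, N ≤ m → M ≤ m → (∀ i, i < m → ((e (u i)).1 = .call ↔ i < N)) →
      (∀ i, i < m → ((e (u i)).1 = .ret ↔ M ≤ i)) → m ≤ M + N) {N : ℕ} (hN : N < m)
    (hc : ∀ i, i < N → (e (u i)).1 = .call) (hcN : (e (u N)).1 ≠ .call) :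
    (∀ i, i < m → (e (u i)).1 ≠ .ret → i + N < m) ∧
      ∀ i, i + N < m → τ (i + N) = τ i + 1 := by
  obtain ⟨N', hN', hcall⟩ := exists_threshold (p := fun i => (e (u i)).1 = .call)
    h.call_of_call_succ
  obtain rfl : N' = N := by
    have h1 : ¬ N < N' := fun hlt => hcN ((hcall N hN).2 hlt)
    by_contra hne
    have h2 := (hcall N' (by omega)).1 (hc N' (by omega))
    omega
  obtain ⟨M, hM, hret⟩ := exists_threshold (p := fun i => (e (u i)).1 ≠ .ret)
    (fun i hi hr hr' => hr (h.ret_succ_of_ret i hi hr'))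
  have hm := hcount N' M hN' hM hcall fun i hi => by
    rw [← not_lt, ← hret i hi, not_not]
  -- `f i` is the position one time unit after the non-return `i`. It is squeezed between two bounds
  -- that coincide because of the count.
  choose! f hf using fun i (hi : i < M) => h.exists_later i (by omega) ((hret i (by omega)).2 hi)
  have hmono : ∀ i, i + 1 < M → f i < f (i + 1) := by
    intro i hi
    obtain ⟨-, h1, h2⟩ := hf i (by omega)
    obtain ⟨-, h3, h4⟩ := hf (i + 1) hi
    by_contra hn
    have h5 : τ (f (i + 1)) ≤ τ (f i) := by
      rcases (not_lt.1 hn).eq_or_lt with h5 | h5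
      · rw [h5]
      · exact (h.strictMonoOn h5 h1).le
    rw [h2, h4] at h5
    exact absurd (h.strictMono i (by omega)) (not_lt.2 (le_of_add_le_add_right h5))
  -- `f 0` lies a full time unit after the start, hence behind all calls; strict monotonicity does
  -- the rest.
  have hlow : ∀ i, i < M → N' + i ≤ f i := by
    intro i hi
    induction i with
    | zero =>
      obtain ⟨h0, h1, h2⟩ := hf 0 hi
      have h3 := h.not_call (f 0) h0 h1 h2.ge
      rw [Ne, hcall _ h1] at h3
      omega
    | succ i ih =>
      have h1 := ih (by omega)
      have h2 := hmono i hi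
      omega
  -- Here `d` is the number of non-returns after `i`: their `d` images must still fit between `f i`
  -- and the end of the word.
  have hhigh : ∀ d i, i + d + 1 = M → f i + d + 1 ≤ m := by
    intro d
    induction d with
    | zero => intro i hi; exact (hf i (by omega)).2.1
    | succ d ih =>
      intro i hi
      have h1 := ih (i + 1) (by omega)
      have h2 := hmono i (by omega)
      omega
  have heq : ∀ i, i < M → f i = i + N' := by
    intro i hi
    have h1 := hlow i hi
    have h2 := hhigh (M - 1 - i) i (by omega)
    omega
  refine ⟨fun i hi hr => ?_, fun i hi => ?_⟩
  · have hi' := (hret i hi).1 hr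
    rw [← heq i hi']
    exact (hf i hi').2.1
  · have hi' : i < M := by omega
    rw [← heq i hi']
    exact (hf i hi').2.2

end RowSystem

/-! ### Rows of configurations of a Turing machine -/

namespace TuringRows

variable {Γ Q : Type} [Inhabited Γ]

/-- The letter at position `k` of the row of length `N` for a configuration. -/
def rowLetter (N : ℕ) (p : TM0.Cfg Γ Q × ℤ) (k : ℕ) : Option (Γ × Option Q) :=
  if k = 0 ∨ k = N then none
  else some (p.1.Tape.nth (k - p.2), if (k : ℤ) = p.2 then some p.1.q else none)

theorem rowLetter_of_ne {N : ℕ} {p : TM0.Cfg Γ Q × ℤ} {k : ℕ} (h0 : k ≠ 0) (hN : k ≠ N) :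
    rowLetter N p k =
      some (p.1.Tape.nth (k - p.2), if (k : ℤ) = p.2 then some p.1.q else none) :=
  if_neg (by tauto)

theorem rowLetter_eq_none {N : ℕ} {p : TM0.Cfg Γ Q × ℤ} {k : ℕ} :
    rowLetter N p k = none ↔ k = 0 ∨ k = N := by
  unfold rowLetter
  split <;> simp_all

variable [Inhabited Q] (M : TM0.Machine Γ Q)

/-- The state entered when the machine moves in direction `d` from a cell. -/
def moveTo (d : Dir) : Option (Γ × Option Q) → Option Q
  | some (s, some q) =>
    match M q s with
    | some (q', .move d') => if d' = d then some q' else none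
    | _ => none
  | _ => none

open Classical in
/-- The letter below `y`, if `x` is to the left and `z` to the right of `y`; `none` is the
separator of the rows, and a cell with a state is the one scanned by the head. -/
noncomputable def below (x y z : Option (Γ × Option Q)) : Option (Option (Γ × Option Q)) :=
  match y with
  | none => some none
  | some (s, none) => some (some (s, (moveTo M .right x).or (moveTo M .left z)))
  | some (s, some q) =>
    match M q s with
    | none => some (some (s, some q))
    | some (q', .write a) => some (some (a, some q'))
    | some (_, .move .left) => if x = none then none else some (some (s, none))
    | some (_, .move .right) => if z = none then none else some (some (s, none))

/-- The row system of a machine. -/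
noncomputable def system : RowSystem (Option (Γ × Option Q)) where
  sep := none
  blank := some (default, none)
  window x y z b := below M x y z = some b
  halt a := ∃ s q, a = some (s, some q) ∧ M q s = none

/-- One step of the machine on configurations with an absolute head position; halting
configurations do not change. -/
def advance (p : TM0.Cfg Γ Q × ℤ) : TM0.Cfg Γ Q × ℤ :=
  match M p.1.q p.1.Tape.head with
  | none => p
  | some (q', .write a) => (⟨q', p.1.Tape.write a⟩, p.2)
  | some (q', .move .left) => (⟨q', p.1.Tape.move .left⟩, p.2 - 1)
  | some (q', .move .right) => (⟨q', p.1.Tape.move .right⟩, p.2 + 1)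

theorem moveTo_rowLetter_of_ne {N : ℕ} {p : TM0.Cfg Γ Q × ℤ} {k : ℕ} {d : Dir}
    (h : (k : ℤ) ≠ p.2) : moveTo M d (rowLetter N p k) = none := by
  unfold rowLetter
  split
  · rfl
  · rfl

theorem moveTo_rowLetter_of_eq {N : ℕ} {p : TM0.Cfg Γ Q × ℤ} {k : ℕ} {d : Dir}
    (h : (k : ℤ) = p.2) (h0 : k ≠ 0) (hN : k ≠ N) : moveTo M d (rowLetter N p k) =
      match M p.1.q p.1.Tape.head with
      | some (q', .move d') => if d' = d then some q' else none
      | _ => none := by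
  rw [rowLetter_of_ne h0 hN, if_pos h, h, sub_self, Tape.nth_zero]
  rfl

/-- A symbol changes only under the head, and the head enters a cell only from a neighbour, so three
letters determine the one below. At most one of the two neighbours carries the state, hence the `or`
in `below` is unambiguous. -/
theorem below_rowLetter {N : ℕ} {p : TM0.Cfg Γ Q × ℤ} (hp : 0 < p.2) (hpN : p.2 < N)
    (ha : 0 < (advance M p).2) (haN : (advance M p).2 < N) {k : ℕ} (hk : 0 < k) (hkN : k < N) :
    below M (rowLetter N p (k - 1)) (rowLetter N p k) (rowLetter N p (k + 1)) =
      some (rowLetter N (advance M p) k) := by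
  obtain ⟨⟨q, T⟩, h⟩ := p
  dsimp only at hp hpN
  rw [rowLetter_of_ne (p := advance M _) hk.ne' hkN.ne]
  by_cases hkh : (k : ℤ) = h
  · rw [rowLetter_of_ne (k := k) hk.ne' hkN.ne]
    dsimp only
    rw [if_pos hkh]
    subst hkh
    simp only [below, sub_self, Tape.nth_zero, rowLetter_eq_none]
    unfold advance at ha haN ⊢
    dsimp only at ha haN ⊢
    rcases hM : M q T.head with _ | ⟨q', ⟨_ | _⟩ | a⟩ <;> rw [hM] at ha haN <;>
      dsimp only at ha haN ⊢
    · simp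
    -- The neighbour entered by the head is no separator, as the new head position is inside the
    -- row.
    · rw [if_neg (by omega)]
      simp only [Tape.move_left_nth]
      rw [if_neg (by omega), sub_sub_cancel, sub_self, Tape.nth_zero]
    · rw [if_neg (by omega)]
      simp
    · rw [sub_self, if_pos rfl]
      rfl
  · rw [rowLetter_of_ne (k := k) hk.ne' hkN.ne]
    dsimp only
    rw [if_neg hkh]
    simp only [below]
    have hl : (k : ℤ) ≠ h + 1 → moveTo M .right (rowLetter N (⟨q, T⟩, h) (k - 1)) = none :=
      fun hne => moveTo_rowLetter_of_ne M (by dsimp only; omega)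
    have hr : (k : ℤ) ≠ h - 1 → moveTo M .left (rowLetter N (⟨q, T⟩, h) (k + 1)) = none :=
      fun hne => moveTo_rowLetter_of_ne M (by dsimp only; omega)
    have hl' : (k : ℤ) = h + 1 → moveTo M .right (rowLetter N (⟨q, T⟩, h) (k - 1)) =
        match M q T.head with
        | some (q', .move d') => if d' = .right then some q' else none
        | _ => none :=
      fun hne => moveTo_rowLetter_of_eq M (by dsimp only; omega) (by omega) (by omega)
    have hr' : (k : ℤ) = h - 1 → moveTo M .left (rowLetter N (⟨q, T⟩, h) (k + 1)) =
        match M q T.head with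
        | some (q', .move d') => if d' = .left then some q' else none
        | _ => none :=
      fun hne => moveTo_rowLetter_of_eq M (by dsimp only; omega) (by omega) (by omega)
    unfold advance
    dsimp only
    rcases hM : M q T.head with _ | ⟨q', ⟨_ | _⟩ | a⟩ <;> rw [hM] at hl' hr' <;>
      dsimp only at hl' hr' ⊢
    · have h1 : moveTo M .right (rowLetter N (⟨q, T⟩, h) (k - 1)) = none := by
        by_cases hc : (k : ℤ) = h + 1
        exacts [hl' hc, hl hc]
      have h2 : moveTo M .left (rowLetter N (⟨q, T⟩, h) (k + 1)) = none := by
        by_cases hc : (k : ℤ) = h - 1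
        exacts [hr' hc, hr hc]
      rw [h1, h2, if_neg hkh]; rfl
    · have h1 : moveTo M .right (rowLetter N (⟨q, T⟩, h) (k - 1)) = none := by
        by_cases hc : (k : ℤ) = h + 1
        exacts [hl' hc, hl hc]
      rw [h1, Tape.move_left_nth, show (k : ℤ) - (h - 1) - 1 = k - h by ring]
      by_cases hc : (k : ℤ) = h - 1
      · rw [hr' hc, if_pos hc]; rfl
      · rw [hr hc, if_neg hc]; rfl
    · have h2 : moveTo M .left (rowLetter N (⟨q, T⟩, h) (k + 1)) = none := by
        by_cases hc : (k : ℤ) = h - 1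
        exacts [hr' hc, hr hc]
      rw [h2, Tape.move_right_nth, show (k : ℤ) - (h + 1) + 1 = k - h by ring]
      by_cases hc : (k : ℤ) = h + 1
      · rw [hl' hc, if_pos hc]; rfl
      · rw [hl hc, if_neg hc]; rfl
    · have h1 : moveTo M .right (rowLetter N (⟨q, T⟩, h) (k - 1)) = none := by
        by_cases hc : (k : ℤ) = h + 1
        exacts [hl' hc, hl hc]
      have h2 : moveTo M .left (rowLetter N (⟨q, T⟩, h) (k + 1)) = none := by
        by_cases hc : (k : ℤ) = h - 1
        exacts [hr' hc, hr hc]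
      rw [h1, h2, if_neg hkh, Tape.write_nth, if_neg (by omega)]; rfl

/-- If the head leaves the row, then there is no admissible letter below the scanned cell. -/
theorem below_rowLetter_eq_none {N : ℕ} {p : TM0.Cfg Γ Q × ℤ} (hp : 0 < p.2) (hpN : p.2 < N)
    (ha : ¬ (0 < (advance M p).2 ∧ (advance M p).2 < N)) {k : ℕ} (hk : (k : ℤ) = p.2) :
    below M (rowLetter N p (k - 1)) (rowLetter N p k) (rowLetter N p (k + 1)) = none := by
  obtain ⟨⟨q, T⟩, h⟩ := p
  dsimp only at hp hpN hk
  subst hk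
  rw [rowLetter_of_ne (k := k) (by omega) (by omega)]
  dsimp only
  rw [if_pos rfl]
  simp only [below, sub_self, Tape.nth_zero, rowLetter_eq_none]
  unfold advance at ha
  dsimp only at ha
  rcases hM : M q T.head with _ | ⟨q', ⟨_ | _⟩ | a⟩ <;> rw [hM] at ha <;> dsimp only at ha ⊢
  · omega
  · rw [if_pos (by omega)]
  · rw [if_pos (by omega)]
  · omega

theorem abs_advance_sub_le (p : TM0.Cfg Γ Q × ℤ) : |(advance M p).2 - p.2| ≤ 1 := by
  unfold advance
  split <;> simp

/-- Bounds the cells visited, and thereby the row length needed, by the number of steps. -/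
theorem abs_iterate_advance_sub_le (p : TM0.Cfg Γ Q × ℤ) (r : ℕ) :
    |((advance M)^[r] p).2 - p.2| ≤ r := by
  induction r with
  | zero => simp
  | succ r ih =>
    rw [Function.iterate_succ_apply']
    have := abs_advance_sub_le M ((advance M)^[r] p)
    push_cast
    rw [abs_le] at *
    constructor <;> linarith [this.1, this.2, ih.1, ih.2]

theorem step_eq_some {c c' : TM0.Cfg Γ Q} (h : ℤ) (hc : TM0.step M c = some c') :
    (advance M (c, h)).1 = c' := by
  obtain ⟨q, T⟩ := c
  unfold TM0.step at hc
  unfold advance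
  dsimp only at hc ⊢
  rcases hM : M q T.head with _ | ⟨q', ⟨_ | _⟩ | a⟩ <;> rw [hM] at hc <;> simp at hc ⊢ <;> exact hc

theorem step_eq_none {c : TM0.Cfg Γ Q} :
    TM0.step M c = none ↔ M c.q c.Tape.head = none := by
  obtain ⟨q, T⟩ := c
  unfold TM0.step
  simp

/-- `advance` is a total version of the step function that stands still after halting, so
termination means that its orbit meets a halting configuration. The absolute head position `h` is
mere bookkeeping. -/
theorem eval_dom_iff (c : TM0.Cfg Γ Q) (h : ℤ) :
    (StateTransition.eval (TM0.step M) c).Dom ↔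
      ∃ r, TM0.step M ((advance M)^[r] (c, h)).1 = none := by
  rw [Part.dom_iff_mem]
  simp only [StateTransition.mem_eval]
  constructor
  · rintro ⟨b, hb, hn⟩
    obtain ⟨r, rfl⟩ : ∃ r, ((advance M)^[r] (c, h)).1 = b := by
      clear hn
      induction hb with
      | refl => exact ⟨0, rfl⟩
      | tail _ hs ih =>
        obtain ⟨r, rfl⟩ := ih
        refine ⟨r + 1, ?_⟩
        rw [Function.iterate_succ_apply']
        exact step_eq_some M _ hs
    exact ⟨r, hn⟩
  · rintro ⟨r, hr⟩
    refine ⟨_, ?_, hr⟩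
    clear hr
    induction r with
    | zero => exact Relation.ReflTransGen.refl
    | succ r ih =>
      rw [Function.iterate_succ_apply']
      rcases hs : TM0.step M ((advance M)^[r] (c, h)).1 with _ | c'
      · have : advance M ((advance M)^[r] (c, h)) = (advance M)^[r] (c, h) := by
          rw [step_eq_none] at hs
          unfold advance at hs ⊢
          rw [hs]
        rwa [this]
      · have h1 := step_eq_some M ((advance M)^[r] (c, h)).2 hs
        exact ih.tail (hs.trans (congrArg some h1.symm))

theorem nth_mk₁_nat (l : List Γ) (n : ℕ) : (Tape.mk₁ l).nth n = l.getI n := by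
  rw [Tape.mk₁, Tape.mk₂, Tape.mk'_nth_nat, ListBlank.nth_mk]

theorem nth_mk₁_of_neg (l : List Γ) {k : ℤ} (hk : k < 0) : (Tape.mk₁ l).nth k = default := by
  obtain ⟨n, rfl⟩ : ∃ n : ℕ, k = Int.negSucc n := ⟨(-k - 1).toNat, by omega⟩
  -- Negative indices read the left half of the tape, which is empty at the start.
  change (ListBlank.mk ([] : List Γ)).nth n = default
  rw [ListBlank.nth_mk]
  simp

/-- The initial cells for the input `a :: l`. -/
def input (a : Γ) (l : List Γ) : List (Option (Γ × Option Q)) :=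
  some (a, some default) :: l.map fun b => some (b, none)

/-- The initial row. -/
theorem rowLetter_init {a : Γ} {l : List Γ} {N h : ℕ} (hh : 0 < h) (hN : h + l.length < N)
    {k : ℕ} (hk : 0 < k) (hkN : k < N) :
    rowLetter N ((TM0.init (a :: l) : TM0.Cfg Γ Q), (h : ℤ)) k =
      if k < h then some (default, none)
      else ((input a l)[k - h]?).getD (some (default, none)) := by
  rw [rowLetter_of_ne hk.ne' hkN.ne]
  simp only [TM0.init]
  split_ifs with h1 h2 h2
  · omega
  · have : k = h := by omega
    subst this
    rw [sub_self]
    simp [input, Tape.mk₁, Tape.mk₂, Tape.mk']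
  · rw [nth_mk₁_of_neg _ (by omega)]
  · obtain ⟨d, rfl⟩ : ∃ d, k = h + (d + 1) := ⟨k - h - 1, by omega⟩
    rw [show ((h + (d + 1) : ℕ) : ℤ) - h = ((d + 1 : ℕ) : ℤ) by push_cast; ring, nth_mk₁_nat,
      show h + (d + 1) - h = d + 1 by omega]
    simp only [input, List.getElem?_cons_succ, List.getElem?_map]
    rw [List.getI_cons_succ]
    by_cases hd : d < l.length
    · rw [List.getI_eq_getElem _ hd, List.getElem?_eq_getElem hd]; rfl
    · rw [List.getI_eq_default _ (by omega), List.getElem?_eq_none (by omega)]; rfl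

end TuringRows

/-! ### Encodings correspond to halting computations -/

namespace TuringRows

variable {Γ Q σ : Type} [Inhabited Γ] [Inhabited Q] (M : TM0.Machine Γ Q)
  (e : σ ≃ SymbolKind × Option (Γ × Option Q)) {a : Γ} {l : List Γ} {u : ℕ → σ} {τ : ℕ → ℝ≥0}
  {m : ℕ}

theorem system_sep : (system M).sep = none := rfl

theorem system_blank : (system M).blank = some (default, none) := rfl

theorem system_window {x y z b : Option (Γ × Option Q)} :
    (system M).window x y z b ↔ below M x y z = some b := Iff.rfl

theorem system_halt_rowLetter {N : ℕ} {p : TM0.Cfg Γ Q × ℤ} {k : ℕ} :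
    (system M).halt (rowLetter N p k) ↔
      k ≠ 0 ∧ k ≠ N ∧ (k : ℤ) = p.2 ∧ TM0.step M p.1 = none := by
  rw [step_eq_none]
  constructor
  · rintro ⟨s, q, h1, h2⟩
    have h0 : ¬ (k = 0 ∨ k = N) := by
      rw [← rowLetter_eq_none (p := p), h1]
      simp
    rw [not_or] at h0
    rw [rowLetter_of_ne h0.1 h0.2] at h1
    by_cases hk : (k : ℤ) = p.2
    · rw [if_pos hk, hk, sub_self, Tape.nth_zero] at h1
      obtain ⟨rfl, rfl⟩ : p.1.Tape.head = s ∧ p.1.q = q := by simpa using h1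
      exact ⟨h0.1, h0.2, hk, h2⟩
    · rw [if_neg hk] at h1
      simp at h1
  · rintro ⟨h1, h2, h3, h4⟩
    refine ⟨p.1.Tape.head, p.1.q, ?_, h4⟩
    rw [rowLetter_of_ne h1 h2, if_pos h3, h3, sub_self, Tape.nth_zero]

/-- If the number of returns is at most the number of calls, then the rows of an encoding are
the successive configurations of the machine, and so the machine halts. -/
theorem dom_of_isEncoding (h : (system M).IsEncoding e (input a l) u τ m)
    (hcount : ∀ N M, N ≤ m → M ≤ m → (∀ i, i < m → ((e (u i)).1 = .call ↔ i < N)) →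
      (∀ i, i < m → ((e (u i)).1 = .ret ↔ M ≤ i)) → m ≤ M + N) :
    (StateTransition.eval (TM0.step M) (TM0.init (a :: l))).Dom := by
  obtain ⟨hd, N, hd0, hlN, hNm, hb1, hin, hb2, hcN⟩ := h.first_row
  rw [system_blank] at hb1 hb2
  have hlen : (input (Q := Q) a l).length = l.length + 1 := by simp [input]
  rw [hlen] at hlN hb2
  have hrow0 : ∀ k, 0 < k → k < N → u k = e.symm (.call,
      rowLetter N ((TM0.init (a :: l) : TM0.Cfg Γ Q), (hd : ℤ)) k) := by
    intro k hk hkN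
    rw [rowLetter_init hd0 (by omega) hk hkN]
    split_ifs with hkd
    · exact hb1 k hk hkd
    · obtain ⟨d, rfl⟩ : ∃ d, k = hd + d := ⟨k - hd, by omega⟩
      rw [Nat.add_sub_cancel_left]
      by_cases hdl : d < (input (Q := Q) a l).length
      · rw [List.getElem?_eq_getElem hdl]
        exact hin d hdl
      · rw [List.getElem?_eq_none (by omega)]
        exact hb2 _ (by omega) hkN
  have hcall : ∀ i, i < N → (e (u i)).1 = .call := by
    intro i hi
    rcases Nat.eq_zero_or_pos i with rfl | hi0
    · rw [h.zero, Equiv.apply_symm_apply]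
    · rw [hrow0 i hi0 hi, Equiv.apply_symm_apply]
  obtain ⟨hnext, htime⟩ := h.later_eq hcount hNm hcall hcN
  have hsep := fun i (hi : i + N < m) => h.sep i (i + N) (by omega) hi (htime i hi)
  rw [system_sep] at hsep
  set P : ℕ → TM0.Cfg Γ Q × ℤ := fun r => (advance M)^[r] (TM0.init (a :: l), (hd : ℤ)) with hP
  -- Induction over complete rows. The index `k = N`, the separator opening the next row, is
  -- included because the window at `N - 1` reads it; it may be missing at the end of the word.
  have hrows : ∀ r, (r + 1) * N ≤ m → 0 < (P r).2 ∧ (P r).2 < N ∧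
      ∀ k ≤ N, r * N + k < m → (e (u (r * N + k))).2 = rowLetter N (P r) k := by
    intro r
    induction r with
    | zero =>
      intro _
      refine ⟨by simpa [hP] using hd0, by simp [hP]; omega, fun k hk hkm => ?_⟩
      rw [zero_mul, zero_add] at hkm ⊢
      have hz : (e (u 0)).2 = none := by rw [h.zero, Equiv.apply_symm_apply]; rfl
      rcases Nat.eq_zero_or_pos k with rfl | hk0
      · rw [rowLetter_eq_none.2 (Or.inl rfl), hz]
      · rcases hk.eq_or_lt with rfl | hkN
        · have := hsep 0 (by omega) hz
          rw [zero_add] at this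
          rw [rowLetter_eq_none.2 (Or.inr rfl), this]
        · rw [hrow0 k hk0 hkN, Equiv.apply_symm_apply]
          rfl
    | succ r ih =>
      intro hr
      have e1 : (r + 1) * N = r * N + N := by ring
      have e2 : (r + 1 + 1) * N = r * N + N + N := by ring
      rw [e2] at hr
      obtain ⟨ih1, ih2, ih3⟩ := ih (by omega)
      have hwin : ∀ k, 0 < k → k < N →
          below M (rowLetter N (P r) (k - 1)) (rowLetter N (P r) k) (rowLetter N (P r) (k + 1)) =
            some (e (u (r * N + N + k))).2 := by
        intro k hk hkN
        obtain ⟨k, rfl⟩ : ∃ k', k = k' + 1 := ⟨k - 1, by omega⟩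
        have := h.window (r * N + k) (r * N + k + 1 + N) (by omega) (by omega) (by omega)
          (htime _ (by omega))
        rw [system_window] at this
        rw [← ih3 (k + 1 - 1) (by omega) (by omega), ← ih3 (k + 1) (by omega) (by omega),
          ← ih3 (k + 1 + 1) (by omega) (by omega),
          show r * N + N + (k + 1) = r * N + k + 1 + N by ring]
        exact this
      have hadv : P (r + 1) = advance M (P r) := Function.iterate_succ_apply' _ _ _
      have hhead : 0 < (P (r + 1)).2 ∧ (P (r + 1)).2 < N := by
        -- If the head left the row, no letter would be admissible below the scanned cell, yet the
        -- word has one there.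
        by_contra hn
        rw [hadv] at hn
        obtain ⟨k, hk⟩ : ∃ k : ℕ, (k : ℤ) = (P r).2 := ⟨(P r).2.toNat, by omega⟩
        have h1 := below_rowLetter_eq_none M ih1 ih2 hn hk
        rw [hwin k (by omega) (by omega)] at h1
        simp at h1
      refine ⟨hhead.1, hhead.2, fun k hk hkm => ?_⟩
      rw [e1] at hkm ⊢
      have hz : (e (u (r * N))).2 = none := by
        have := ih3 0 (by omega) (by omega)
        rwa [rowLetter_eq_none.2 (Or.inl rfl)] at this
      have hz' := hsep (r * N) (by omega) hz
      rcases Nat.eq_zero_or_pos k with rfl | hk0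
      · rw [rowLetter_eq_none.2 (Or.inl rfl)]
        exact hz'
      · rcases hk.eq_or_lt with rfl | hkN
        · rw [rowLetter_eq_none.2 (Or.inr rfl)]
          exact hsep (r * k + k) hkm hz'
        · have h1 := hwin k hk0 hkN
          rw [hadv] at hhead ⊢
          rw [below_rowLetter M ih1 ih2 hhead.1 hhead.2 hk0 hkN] at h1
          exact (Option.some.inj h1).symm
  obtain ⟨i, -, him, hhalt, hret⟩ := h.halt
  -- The halting letter is no return, so the word extends at least `N` positions beyond it and its
  -- row is complete.
  have hiN := hnext i him hret
  have hN0 : 0 < N := by omega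
  have hdiv := Nat.div_add_mod' i N
  have hmod := Nat.mod_lt i hN0
  have e1 : (i / N + 1) * N = i / N * N + N := by ring
  obtain ⟨-, -, h3⟩ := hrows (i / N) (by omega)
  have h4 := h3 (i % N) hmod.le (by omega)
  rw [hdiv] at h4
  rw [h4, system_halt_rowLetter] at hhalt
  exact (eval_dom_iff M _ (hd : ℤ)).2 ⟨i / N, hhalt.2.2.2⟩

theorem advance_fst_congr {p p' : TM0.Cfg Γ Q × ℤ} (h : p.1 = p'.1) :
    (advance M p).1 = (advance M p').1 := by
  unfold advance
  rw [h]
  split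
  · exact h
  all_goals rfl

theorem iterate_advance_fst (c : TM0.Cfg Γ Q) (h h' : ℤ) (r : ℕ) :
    ((advance M)^[r] (c, h)).1 = ((advance M)^[r] (c, h')).1 := by
  induction r with
  | zero => rfl
  | succ r ih =>
    rw [Function.iterate_succ_apply', Function.iterate_succ_apply']
    exact advance_fst_congr M ih

/-- A halting computation is encoded with rows that are long enough for the head never to leave
them, and with equidistant time stamps. -/
theorem exists_isEncoding (hdom : (StateTransition.eval (TM0.step M) (TM0.init (a :: l))).Dom) :
    ∃ (u : ℕ → σ) (τ : ℕ → ℝ≥0) (N R m : ℕ), 0 < m ∧ (system M).IsEncoding e (input a l) u τ m ∧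
      (∀ i, i < m → ((e (u i)).1 = .call ↔ i < N)) ∧
      (∀ i, i < m → ((e (u i)).1 = .ret ↔ R ≤ i)) ∧ m ≤ R + N := by
  have hlen : (input (Q := Q) a l).length = l.length + 1 := by simp [input]
  obtain ⟨R, hR⟩ := (eval_dom_iff M _ 0).1 hdom
  -- Rows `0` to `R + 1` are written, so the head stays within distance `R + 1` of `h₀`. The choices
  -- of `h₀` and `N` keep it strictly between the separators at `0` and `N` and leave room for the
  -- input.
  obtain ⟨h₀, hh₀⟩ : ∃ h₀, h₀ = R + 2 := ⟨_, rfl⟩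
  obtain ⟨N, hN⟩ : ∃ N, N = h₀ + R + 2 + l.length := ⟨_, rfl⟩
  have hN0 : 0 < N := by omega
  rw [iterate_advance_fst M _ 0 (h₀ : ℤ)] at hR
  set P : ℕ → TM0.Cfg Γ Q × ℤ := fun r => (advance M)^[r] (TM0.init (a :: l), (h₀ : ℤ)) with hP
  have hhead : ∀ r ≤ R + 1, 0 < (P r).2 ∧ (P r).2 < N := by
    intro r hr
    have := abs_iterate_advance_sub_le M (TM0.init (a :: l), (h₀ : ℤ)) r
    rw [abs_le] at this
    dsimp only at this
    change -(r : ℤ) ≤ (P r).2 - h₀ ∧ (P r).2 - h₀ ≤ r at this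
    omega
  let v : ℕ → Option (Γ × Option Q) := fun i => rowLetter N (P (i / N)) (i % N)
  have hv : ∀ r k, k < N → v (r * N + k) = rowLetter N (P r) k := by
    intro r k hk
    simp only [v]
    rw [add_comm, Nat.add_mul_div_right _ _ hN0, Nat.div_eq_of_lt hk, zero_add,
      Nat.add_mul_mod_self_right, Nat.mod_eq_of_lt hk]
  -- Index `N` of a row is the separator at index `0` of the next one.
  have hv' : ∀ r k, k ≤ N → v (r * N + k) = rowLetter N (P r) k := by
    intro r k hk
    rcases hk.eq_or_lt with rfl | hk
    · have := hv (r + 1) 0 hN0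
      rw [show (r + 1) * k + 0 = r * k + k by ring] at this
      rw [this, rowLetter_eq_none.2 (Or.inl rfl), rowLetter_eq_none.2 (Or.inr rfl)]
    · exact hv r k hk
  -- Row `0` consists of calls and row `R + 1` of returns. The extra row after the halting one makes
  -- the halting letter a non-return.
  let κ : ℕ → SymbolKind := fun i =>
    if i < N then .call else if i < (R + 1) * N then .internal else .ret
  have e1 : (R + 1) * N = R * N + N := by ring
  have hκc : ∀ i, κ i = .call ↔ i < N := by
    intro i
    simp only [κ]
    split_ifs <;> simp_all
  have hκr : ∀ i, κ i = .ret ↔ (R + 1) * N ≤ i := by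
    intro i
    simp only [κ]
    split_ifs with h1 h2
    · simp; nlinarith
    · simpa using h2
    · simpa using h2
  -- With this spacing, one time unit later means exactly `N` positions later.
  let τ : ℕ → ℝ≥0 := fun i => (i : ℝ≥0) / N
  have hN' : (N : ℝ≥0) ≠ 0 := by exact_mod_cast hN0.ne'
  have hτ : ∀ i j, τ j = τ i + 1 ↔ j = i + N := by
    intro i j
    simp only [τ]
    rw [div_add_one hN', div_left_inj' hN']
    exact_mod_cast Iff.rfl
  have hτ' : ∀ i j, τ i + 1 ≤ τ j ↔ i + N ≤ j := by
    intro i j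
    simp only [τ]
    rw [div_add_one hN', div_le_div_iff_of_pos_right (pos_iff_ne_zero.2 hN')]
    exact_mod_cast Iff.rfl
  let u : ℕ → σ := fun i => e.symm (κ i, v i)
  have hu1 : ∀ i, (e (u i)).1 = κ i := fun i => by simp [u]
  have hu2 : ∀ i, (e (u i)).2 = v i := fun i => by simp [u]
  have hcall : ∀ i, i < N → u i = e.symm (.call, v i) := fun i hi => by
    simp only [u, (hκc i).2 hi]
  have hrow0 : ∀ k, 0 < k → k < N → v k = if k < h₀ then some (default, none)
      else ((input a l)[k - h₀]?).getD (some (default, none)) := by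
    intro k hk hkN
    rw [← rowLetter_init (N := N) (by omega) (by omega) hk hkN]
    have := hv 0 k hkN
    rwa [zero_mul, zero_add] at this
  refine ⟨u, τ, N, (R + 1) * N, (R + 2) * N, by positivity, ?_, fun i _ => by rw [hu1, hκc],
    fun i _ => by rw [hu1, hκr], le_of_eq (by ring)⟩
  have e2 : (R + 2) * N = R * N + N + N := by ring
  constructor
  · intro i _
    simp only [τ]
    rw [div_lt_div_iff_of_pos_right (pos_iff_ne_zero.2 hN')]
    exact_mod_cast Nat.lt_succ_self i
  · intro i _
    simp only [hu1, hκc]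
    omega
  · intro i _
    simp only [hu1, hκr]
    omega
  · intro i _ _ h1
    rw [hτ'] at h1
    rw [hu1, Ne, hκc]
    omega
  · intro i _ h1
    rw [hu1, Ne, hκr] at h1
    exact ⟨i + N, by omega, by omega, (hτ _ _).2 rfl⟩
  · intro i j _ _ hj h1
    rw [hτ] at h1
    subst h1
    simp only [hu2, system_window]
    have hdiv := Nat.div_add_mod' (i + 1) N
    have hmod := Nat.mod_lt (i + 1) hN0
    set r := (i + 1) / N
    set k := (i + 1) % N
    have e3 : (r + 1) * N = r * N + N := by ring
    have hr : r < R + 1 := by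
      by_contra hn
      have := Nat.mul_le_mul_right N (not_lt.1 hn)
      omega
    have hvj : v (i + 1 + N) = rowLetter N (P (r + 1)) k := by
      rw [← hv (r + 1) k hmod]
      congr 1; omega
    have hv1 : v (i + 1) = rowLetter N (P r) k := by
      rw [← hv r k hmod, hdiv]
    rw [hvj, hv1]
    rcases Nat.eq_zero_or_pos k with hk | hk
    · rw [hk, rowLetter_eq_none.2 (Or.inl rfl), rowLetter_eq_none.2 (Or.inl rfl)]
      rfl
    · have hv0 : v i = rowLetter N (P r) (k - 1) := by
        rw [← hv r (k - 1) (by omega)]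
        congr 1; omega
      have hv2 : v (i + 2) = rowLetter N (P r) (k + 1) := by
        rw [← hv' r (k + 1) (by omega)]
        congr 1; omega
      have hadv : P (r + 1) = advance M (P r) := Function.iterate_succ_apply' _ _ _
      have h1 := hhead r (by omega)
      have h2 := hhead (r + 1) (by omega)
      rw [hadv] at h2 ⊢
      rw [hv0, hv2]
      exact below_rowLetter M h1.1 h1.2 h2.1 h2.2 hk hmod
  · intro i j _ _ h1
    rw [hτ] at h1
    subst h1
    simp only [hu2, system_sep, v]
    rw [Nat.add_div_right _ hN0, Nat.add_mod_right, rowLetter_eq_none, rowLetter_eq_none]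
    exact id
  · obtain ⟨h1, h2⟩ := hhead R (by omega)
    obtain ⟨k, hk⟩ : ∃ k : ℕ, (k : ℤ) = (P R).2 := ⟨(P R).2.toNat, by omega⟩
    refine ⟨R * N + k, by omega, by omega, ?_, ?_⟩
    · rw [hu2, hv R k (by omega), system_halt_rowLetter]
      exact ⟨by omega, by omega, hk, hR⟩
    · rw [hu1, Ne, hκr]
      omega
  · rw [hcall 0 hN0, system_sep]
    have := hv 0 0 hN0
    rw [zero_mul, zero_add, rowLetter_eq_none.2 (Or.inl rfl)] at this
    rw [this]
  · refine ⟨h₀, N, by omega, by omega, by omega, fun i hi hi' => ?_, fun k hk => ?_,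
      fun i hi hi' => ?_, ?_⟩
    · rw [hcall i (by omega), hrow0 i hi (by omega), if_pos hi', system_blank]
    · rw [hcall _ (by omega), hrow0 _ (by omega) (by omega), if_neg (by omega),
        Nat.add_sub_cancel_left, List.getElem?_eq_getElem (by omega)]
      rfl
    · rw [hcall i (by omega), hrow0 i (by omega) (by omega), if_neg (by omega), system_blank,
        List.getElem?_eq_none (by omega)]
      rfl
    · rw [hu1, Ne, hκc]
      omega

end TuringRows

/-! ### The reduction -/

instance : Fintype SymbolKind :=
  ⟨⟨{.internal, .call, .ret}, by simp⟩, fun x => by cases x <;> simp⟩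

/-- Each letter contributes one block of numbers: the prefix of an until over `[0, ∞)` with left
argument `neg tt`, then a conjunction and the atom. The code is thus computable from the list by
concatenation. -/
theorem MTL.code_chain {k : ℕ} (φ : MTL (Fin k)) (l : List (Fin k)) :
    (MTL.chain φ l).code =
      l.flatMap (fun a => [4, 0, 1, 0, 0, 2, 0, 3, 1, a.val]) ++ φ.code := by
  induction l with
  | nil => rfl
  | cons a l ih =>
    have : MTL.chain φ (a :: l) = MTL.next (.and (.atom a) (MTL.chain φ l)) := rfl
    rw [this]
    simp [MTL.next, MTL.nextIn, MTL.code, ih, Interval.all, endpointCode]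

section Reduction

variable {Γ Q : Type} [Inhabited Γ] [Inhabited Q] [Fintype Γ] [Fintype Q] (M : TM0.Machine Γ Q)
  {k : ℕ} (e : Fin k ≃ SymbolKind × Option (Γ × Option Q))

/-- The instance of the model checking problem for a machine and its input `a :: l`. -/
noncomputable def haltingInstance (a : Γ) (l : List Γ) : Instance where
  numLetters := k
  numStack := 1
  numLocs := 1
  numClocks := 0
  aut := counterNet fun s => (e s).1
  formula := .neg ((TuringRows.system M).formula e (some (a, some default))
    (l.map fun b => some (b, none)))

/-- Accepted words violating the formula are exactly the accepted encodings of a computation on the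
input; the count of calls and returns is what acceptance by the net contributes. -/
theorem haltingInstance_holds_iff (a : Γ) (l : List Γ) :
    (haltingInstance M e a l).Holds ↔
      ¬ (StateTransition.eval (TM0.step M) (TM0.init (a :: l))).Dom := by
  constructor
  · intro h hdom
    obtain ⟨u, τ, N, R, m, hm, henc, hcall, hret, hle⟩ :=
      TuringRows.exists_isEncoding M e hdom
    let w : List (Fin k × ℝ≥0) := (List.range' 0 m).map fun i => (u i, τ i)
    have hlen : w.length = m := by simp [w]
    have hu : ∀ i (h : i < w.length), w[i] = (u i, τ i) := by
      intro i hi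
      simp [w]
    have hsorted : (w.map Prod.snd).Pairwise (· ≤ ·) := by
      rw [List.pairwise_iff_getElem]
      intro i j hi hj hij
      simp only [List.length_map] at hi hj
      simp only [List.getElem_map, hu]
      exact (henc.strictMonoOn hij (by omega)).le
    have hne : w ≠ [] := List.ne_nil_of_length_pos (by omega)
    obtain ⟨s', hrun⟩ := counterNet_run_exists (fun s => (e s).1)
      (fun i hi => (henc.strictMono i hi).le) hcall hret hle m 0 0 ⟨0, fun _ => 0, []⟩ (by simp)
      (fun _ => zero_le) (by simp)
    refine h ⟨w, hne, hsorted⟩ ⟨_, s', Finset.mem_singleton_self _, fun _ => rfl, rfl,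
      Finset.mem_singleton.2 (Subsingleton.elim (α := Fin 1) _ _), hrun⟩ ?_
    refine (RowSystem.sat_formula _ e hsorted hu _ _).2 ?_
    rw [hlen]
    exact henc
  · intro h w hw hsat
    obtain ⟨w, hne, hsorted⟩ := w
    have hpos := List.length_pos_of_ne_nil hne
    -- The default `w[0]` only makes the functions total; inside the word it is not used.
    let u : ℕ → Fin k := fun i => (w.getD i w[0]).1
    let τ : ℕ → ℝ≥0 := fun i => (w.getD i w[0]).2
    have hu : ∀ i (h : i < w.length), w[i] = (u i, τ i) := by
      intro i hi
      simp only [u, τ, List.getD_eq_getElem _ _ hi]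
      rfl
    have henc := (RowSystem.sat_formula _ e hsorted hu _ _).1 hsat
    exact h (TuringRows.dom_of_isEncoding M e henc fun N R hN hR hcall hret =>
      length_le_of_mem_language (fun s => (e s).1) hw (fun i hi => congrArg Prod.fst (hu i hi))
        hN hR hcall hret)

/-- Isolates the dependence on `l`: a single concatenated block between two lists that do not
involve `l`. -/
theorem haltingInstance_formula_code (a : Γ) (l : List Γ) :
    (haltingInstance M e a l).formula.code =
      (2 :: 3 :: (((TuringRows.system M).consistent e).code ++
        [4, 0, 1, 0, 0, 1, (e.symm (.call, some (default, none)) : ℕ), 3, 1,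
          (e.symm (.call, some (a, some default)) : ℕ)])) ++
      (l.flatMap (fun b => [4, 0, 1, 0, 0, 2, 0, 3, 1, (e.symm (.call, some (b, none)) : ℕ)]) ++
        ((TuringRows.system M).blankTail e).code) := by
  change (MTL.neg ((TuringRows.system M).formula e (some (a, some default))
    (l.map fun b => some (b, none)))).code = _
  simp only [RowSystem.formula, RowSystem.firstRow, MTL.code, MTL.code_chain, Interval.all,
    endpointCode, List.flatMap_map, TuringRows.system_blank, List.cons_append, List.nil_append,
    List.append_assoc, Bool.toNat_true, Bool.toNat_false]

theorem exists_primrec_describes (a : Γ) (g : Bool → Γ) :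
    ∃ c : ℕ → InstanceCode, Primrec c ∧
      ∀ n, Describes (c n) (haltingInstance M e a (n.bits.reverse.map g)) := by
  -- The automaton is the same for all inputs, so its locations and edges are listed once and enter
  -- the code as constants.
  let P := haltingInstance M e a []
  refine ⟨fun n => ((k, 1, 1, 0), P.aut.init.toList.map Fin.val, P.aut.final.toList.map Fin.val,
    P.aut.edges.toList.map Edge.code,
    (haltingInstance M e a (n.bits.reverse.map g)).formula.code), ?_, fun n =>
    ⟨P.aut.init.toList, P.aut.final.toList, P.aut.edges.toList, fun _ => Finset.mem_toList,
      fun _ => Finset.mem_toList, fun _ => Finset.mem_toList, rfl⟩⟩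
  refine (Primrec.const _).pair ((Primrec.const _).pair ((Primrec.const _).pair
    ((Primrec.const _).pair ?_)))
  simp only [haltingInstance_formula_code, List.flatMap_map]
  refine Primrec.list_append.comp (Primrec.const _) (Primrec.list_append.comp ?_ (Primrec.const _))
  exact Primrec.list_flatMap (Primrec.list_reverse.comp primrec_bits)
    ((Primrec.dom_finite fun b => [4, 0, 1, 0, 0, 2, 0, 3, 1,
      (e.symm (.call, some (g b, none)) : ℕ)]).comp Primrec.snd).to₂

end Reduction

/-! ### Undecidability -/

theorem not_modelCheckingDecidable_deterministic : ¬ ModelCheckingDecidable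
    {P | P.aut.IsVisiblyOneCounterNet ∧ P.aut.HasNoClocks ∧ P.aut.IsDeterministic} := by
  rintro ⟨f, hf, hfP⟩
  obtain ⟨Γ, Q, _, _, _, _, M, a, g, hM⟩ := exists_tm0_undecidable
  let e := (Fintype.equivFin (SymbolKind × Option (Γ × Option Q))).symm
  obtain ⟨c, hc, hcP⟩ := exists_primrec_describes M e a g
  refine hM (ComputablePred.computable_iff.2
    ⟨fun n => !f (c n), Primrec.not.to_comp.comp (hf.comp hc.to_comp), ?_⟩)
  funext n
  have h := hfP _ ⟨counterNet_isVisiblyOneCounterNet _, counterNet_hasNoClocks _,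
    counterNet_isDeterministic _⟩ _ (hcP n)
  rw [haltingInstance_holds_iff] at h
  rw [Bool.not_eq_true', ← Bool.not_eq_true, h, not_not]

theorem ModelCheckingDecidable.mono {C D : Set Instance} (h : C ⊆ D)
    (hD : ModelCheckingDecidable D) : ModelCheckingDecidable C := by
  obtain ⟨f, hf, hfP⟩ := hD
  exact ⟨f, hf, fun P hP => hfP P (h hP)⟩

end TimedMC

theorem mainTheorem5 :
    ¬ TimedMC.ModelCheckingDecidable {P | P.aut.IsVisiblyOneCounterNet} ∧
    ¬ TimedMC.ModelCheckingDecidable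
        {P | P.aut.IsVisiblyOneCounterNet ∧ P.aut.HasNoClocks ∧ P.aut.IsDeterministic} :=
  ⟨fun h => TimedMC.not_modelCheckingDecidable_deterministic (h.mono fun _ hP => hP.1),
    TimedMC.not_modelCheckingDecidable_deterministic⟩
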